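/- Let $\mathscr{C}$ be a symmetric monoidal category which is, as a category, semisimple abelian (abelian, and every object is a coproduct of simple objects), and whose tensor product $\otimes$ is bi-additive; let $\mathbf 1$ be its unit object. All algebras and Hopf algebras in $\mathscr{C}$ are commutative. For a Hopf algebra $Q$ in $\mathscr{C}$, a $Q$-comodule algebra is an algebra $A$ with a right $Q$-comodule structure $A\to A\otimes Q$ that is an algebra morphism. It is called $Q$-smooth if, for every $Q$-comodule algebra $R$ and every nilpotent $Q$-costable ideal $I$ of $R$, every $Q$-colinear algebra morphism $A\to R/I$ lifts to a $Q$-colinear algebra morphism $A\to R$. An algebra $A$ is called smooth if, for every algebra $R$ and every nilpotent ideal $I$ of $R$, every algebra morphism $A\to R/I$ lifts to an algebra morphism $A\to R$. For a right $Q$-comodule $(V,\rho_V)$ and a left $Q$-comodule $(W,\lambda_W)$, let $V\,\square_Q W$ be the equalizer of $\rho_V\otimes\mathrm{id}_W$ and $\mathrm{id}_V\otimes\lambda_W : V\otimes W\rightrightarrows V\otimes Q\otimes W$; $V$ is called coflat if the functor $V\,\square_Q -$ from left $Q$-comodules to $\mathscr{C}$ is exact. Let $H$ be a Hopf algebra in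 $\mathscr{C}$, with counit $\varepsilon_H$ and augmentation ideal $H^+=\operatorname{Ker}(\varepsilon_H: H\to\mathbf 1)$. Let $S^2_H(H^+)$ be the second symmetric power of the $H$-module $H^+$, i.e. the coequalizer of the identity and the symmetry on $H^+\otimes_H H^+$, and let $\mu_H: S^2_H(H^+)\to H^+$ be the morphism induced by the product $H^+\otimes H^+\to H^+$ of $H$. Then the following conditions are equivalent: (a) $H$ is smooth; (b) $H$, with its coproduct as coaction, is $H$-smooth; (c) $H$ is $Q$-smooth for every quotient Hopf algebra $Q$ of $H$ such that $H$ is coflat as a right $Q$-comodule, where $Q$ coacts through $H\to H\otimes H\to H\otimes Q$; (d) $\mu_H: S^2_H(H^+)\to H^+$ is a monomorphism. -/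

import Mathlib

open CategoryTheory MonoidalCategory Limits
open scoped MonObj ComonObj

universe v u

/-- Every object is a coproduct of simple objects. (Projections onto the summands embed the index
set into an endomorphism ring, so index sets in `Type v` are no restriction.) -/
def IsSemisimpleCategory (C : Type u) [Category.{v} C] [HasZeroMorphisms C] : Prop :=
  ∀ X : C, ∃ (J : Type v) (S : J → C) (c : Cofan S),
    (∀ j, Simple (S j)) ∧ Nonempty (IsColimit c) ∧ Nonempty (c.pt ≅ X)

noncomputable section

namespace HopfSmooth

variable {C : Type u} [Category.{v} C] [MonoidalCategory C]

section Nilpotent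

/-- The tensor power `I ⊗ ⋯ ⊗ I`. -/
def tensorPow (I : C) : ℕ → C
  | 0 => 𝟙_ C
  | n + 1 => tensorPow I n ⊗ I

/-- The `n`-fold product `I ⊗ ⋯ ⊗ I ⟶ R` of a subobject `i : I ⟶ R` of an algebra `R`; its image is
the power `Iⁿ` if `I` is an ideal. -/
def mulPow {I R : C} [MonObj R] (i : I ⟶ R) : ∀ n : ℕ, tensorPow I n ⟶ R
  | 0 => η[R]
  | n + 1 => (mulPow i n ⊗ₘ i) ≫ μ[R]

/-- `Iⁿ = 0` for some `n`. -/
def IsNilpotentIdeal [HasZeroMorphisms C] {I R : C} [MonObj R] (i : I ⟶ R) : Prop :=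
  ∃ n : ℕ, mulPow i n = 0

end Nilpotent

section Smooth

variable [BraidedCategory C] [HasZeroMorphisms C] [HasKernels C]

/-- Smoothness of an algebra `A`: algebra morphisms `A ⟶ R / I` lift to `R` for every commutative
algebra `R` and every nilpotent ideal `I` of `R`. The pairs `(I, R ⟶ R / I)` are given by algebra
morphisms `π : R ⟶ S` that are epic in `C`, with `I` the kernel of `π`. -/
def IsSmooth (A : C) [MonObj A] : Prop :=
  ∀ (R S : C) [MonObj R] [IsCommMonObj R] [MonObj S] [IsCommMonObj S]
    (π : R ⟶ S) [IsMonHom π] [Epi π], IsNilpotentIdeal (kernel.ι π) →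
    ∀ (f : A ⟶ S) [IsMonHom f], ∃ g : A ⟶ R, IsMonHom g ∧ g ≫ π = f

end Smooth

section Comodules

/-- Right comodules over a coalgebra `Q`. -/
structure RightComod (Q : C) [ComonObj Q] where
  /-- the underlying object -/
  X : C
  /-- the coaction -/
  coact : X ⟶ X ⊗ Q
  coact_counit : coact ≫ X ◁ ε[Q] = (ρ_ X).inv
  coact_comul : coact ≫ X ◁ Δ[Q] = coact ≫ coact ▷ Q ≫ (α_ X Q Q).hom

/-- Left comodules over a coalgebra `Q`. -/
structure LeftComod (Q : C) [ComonObj Q] where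
  /-- the underlying object -/
  X : C
  /-- the coaction -/
  coact : X ⟶ Q ⊗ X
  coact_counit : coact ≫ ε[Q] ▷ X = (λ_ X).inv
  coact_comul : coact ≫ Q ◁ coact = coact ≫ Δ[Q] ▷ X ≫ (α_ Q Q X).hom

/-- Colinear morphisms of left comodules. -/
@[ext]
structure LeftComod.Hom {Q : C} [ComonObj Q] (V W : LeftComod Q) where
  /-- the underlying morphism -/
  hom : V.X ⟶ W.X
  colinear : V.coact ≫ Q ◁ hom = hom ≫ W.coact

instance {Q : C} [ComonObj Q] : Category (LeftComod Q) where
  Hom V W := LeftComod.Hom V W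
  id V := ⟨𝟙 V.X, by simp⟩
  comp f g := ⟨f.hom ≫ g.hom, by
    rw [MonoidalCategory.whiskerLeft_comp, ← Category.assoc, f.colinear, Category.assoc,
      g.colinear, Category.assoc]⟩

variable [HasEqualizers C]

/-- The cotensor product `V □_Q W`. -/
def cotensorObj {Q : C} [ComonObj Q] (V : RightComod Q) (W : LeftComod Q) : C :=
  equalizer (V.coact ▷ W.X) (V.X ◁ W.coact ≫ (α_ V.X Q W.X).inv)

/-- The inclusion `V □_Q W ⟶ V ⊗ W`. -/
def cotensorι {Q : C} [ComonObj Q] (V : RightComod Q) (W : LeftComod Q) :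
    cotensorObj V W ⟶ V.X ⊗ W.X :=
  equalizer.ι (V.coact ▷ W.X) (V.X ◁ W.coact ≫ (α_ V.X Q W.X).inv)

lemma cotensorι_condition {Q : C} [ComonObj Q] (V : RightComod Q) (W : LeftComod Q) :
    cotensorι V W ≫ V.coact ▷ W.X = cotensorι V W ≫ V.X ◁ W.coact ≫ (α_ V.X Q W.X).inv :=
  equalizer.condition _ _

lemma cotensor_hom_ext {Q : C} [ComonObj Q] {V : RightComod Q} {W : LeftComod Q} {Z : C}
    {f g : Z ⟶ cotensorObj V W} (h : f ≫ cotensorι V W = g ≫ cotensorι V W) : f = g :=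
  equalizer.hom_ext h

/-- The morphism `V □_Q W ⟶ V □_Q W'` induced by a colinear morphism. -/
def cotensorMap {Q : C} [ComonObj Q] (V : RightComod Q) {W W' : LeftComod Q}
    (f : LeftComod.Hom W W') : cotensorObj V W ⟶ cotensorObj V W' :=
  equalizer.lift (cotensorι V W ≫ V.X ◁ f.hom) (by
    rw [Category.assoc, whisker_exchange, ← Category.assoc, cotensorι_condition, Category.assoc,
      Category.assoc, Category.assoc, ← MonoidalCategory.whiskerLeft_comp_assoc, ← f.colinear]
    simp)

lemma cotensorMap_ι {Q : C} [ComonObj Q] (V : RightComod Q) {W W' : LeftComod Q}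
    (f : LeftComod.Hom W W') :
    cotensorMap V f ≫ cotensorι V W' = cotensorι V W ≫ V.X ◁ f.hom :=
  equalizer.lift_ι _ _

/-- The functor `V □_Q -` from left `Q`-comodules. -/
def cotensor {Q : C} [ComonObj Q] (V : RightComod Q) : LeftComod Q ⥤ C where
  obj W := cotensorObj V W
  map f := cotensorMap V f
  map_id W := by
    apply cotensor_hom_ext
    rw [cotensorMap_ι]
    change _ ≫ V.X ◁ (𝟙 W.X) = _
    simp
  map_comp f g := by
    apply cotensor_hom_ext
    rw [cotensorMap_ι, Category.assoc, cotensorMap_ι, ← Category.assoc, cotensorMap_ι]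
    change _ ≫ V.X ◁ (f.hom ≫ g.hom) = _
    simp

/-- `V` is coflat if `V □_Q -` is exact, i.e. sends short exact sequences of left comodules (which
are the sequences of colinear morphisms that are short exact in `C`) to short exact sequences. -/
def IsCoflat [HasZeroMorphisms C] {Q : C} [ComonObj Q] (V : RightComod Q) : Prop :=
  ∀ (W₁ W₂ W₃ : LeftComod Q) (f : W₁ ⟶ W₂) (g : W₂ ⟶ W₃) (w : f.hom ≫ g.hom = 0),
    (ShortComplex.mk f.hom g.hom w).ShortExact →
    ∃ w' : (cotensor V).map f ≫ (cotensor V).map g = 0,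
      (ShortComplex.mk ((cotensor V).map f) ((cotensor V).map g) w').ShortExact

end Comodules

section ComoduleAlgebras

variable [BraidedCategory C]

/-- Commutative (right) `Q`-comodule algebras: the coaction is an algebra morphism. -/
structure ComodAlg (Q : C) [BimonObj Q] extends RightComod Q where
  [mon : MonObj X]
  [comm : IsCommMonObj X]
  [isMonHom_coact : IsMonHom coact]

attribute [instance] ComodAlg.mon ComodAlg.comm ComodAlg.isMonHom_coact

/-- Colinear algebra morphisms. -/
structure IsComodAlgHom {Q : C} [BimonObj Q] (A B : ComodAlg Q) (f : A.X ⟶ B.X) : Prop where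
  isMonHom : IsMonHom f
  colinear : A.coact ≫ f ▷ Q = f ≫ B.coact

/-- `Q`-smoothness of a `Q`-comodule algebra `A`: colinear algebra morphisms `A ⟶ R / I` lift to
colinear algebra morphisms `A ⟶ R` for every `Q`-comodule algebra `R` and every nilpotent
`Q`-costable ideal `I` of `R`; as in `IsSmooth`, `I` is the kernel of an epic `π : R ⟶ S`. -/
def ComodAlg.IsSmooth [HasZeroMorphisms C] [HasKernels C] {Q : C} [BimonObj Q]
    (A : ComodAlg Q) : Prop :=
  ∀ (R S : ComodAlg Q) (π : R.X ⟶ S.X) [Epi π], IsComodAlgHom R S π →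
    IsNilpotentIdeal (kernel.ι π) →
    ∀ f : A.X ⟶ S.X, IsComodAlgHom A S f → ∃ g : A.X ⟶ R.X, IsComodAlgHom A R g ∧ g ≫ π = f

instance isMonHom_comul (H : C) [BimonObj H] : IsMonHom Δ[H] where
  one_hom := BimonObj.one_comul H
  mul_hom := by rw [BimonObj.mul_comul]; simp [MonObj.tensorObj.mul_def]

/-- `H` as an `H`-comodule algebra, through the coproduct. -/
def ComodAlg.regular (H : C) [BimonObj H] [IsCommMonObj H] : ComodAlg H where
  X := H
  coact := Δ[H]
  coact_counit := ComonObj.comul_counit H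
  coact_comul := ComonObj.comul_assoc H

/-- `H` as a `Q`-comodule algebra, through a bialgebra morphism `q : H ⟶ Q`. -/
def ComodAlg.ofHom {H Q : C} [BimonObj H] [IsCommMonObj H] [BimonObj Q] (q : H ⟶ Q)
    [IsBimonHom q] : ComodAlg Q where
  X := H
  coact := Δ[H] ≫ H ◁ q
  coact_counit := by
    rw [Category.assoc, ← MonoidalCategory.whiskerLeft_comp, IsComonHom.hom_counit,
      ComonObj.comul_counit]
  coact_comul := by
    calc _ = Δ[H] ≫ H ◁ (q ≫ Δ[Q]) := by
          rw [MonoidalCategory.whiskerLeft_comp, Category.assoc]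
      _ = (Δ[H] ≫ H ◁ Δ[H]) ≫ H ◁ (q ⊗ₘ q) := by
        rw [IsComonHom.hom_comul, MonoidalCategory.whiskerLeft_comp, Category.assoc]
      _ = _ := by
        rw [ComonObj.comul_assoc]
        simp only [Category.assoc, comp_whiskerRight, whisker_exchange_assoc]
        simp [MonoidalCategory.tensorHom_def]
  isMonHom_coact := by
    have : IsMonHom (H ◁ q) := by
      rw [← id_tensorHom]; infer_instance
    infer_instance

end ComoduleAlgebras

section SymmetricSquare

variable [SymmetricCategory C] [HasCoequalizers C]

/-- The right action on a left module `M` over a (commutative) algebra `A`. -/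
def rightAct (A M : C) [MonObj A] [ModObj A M] : M ⊗ A ⟶ M :=
  (β_ M A).hom ≫ γ[A, M]

/-- The tensor product `M ⊗_A N` of modules over a commutative algebra. -/
def tensorOver (A M N : C) [MonObj A] [ModObj A M] [ModObj A N] : C :=
  coequalizer (rightAct A M ▷ N) ((α_ M A N).hom ≫ M ◁ γ[A, N])

/-- The projection `M ⊗ N ⟶ M ⊗_A N`. -/
def tensorOver.π (A M N : C) [MonObj A] [ModObj A M] [ModObj A N] :
    M ⊗ N ⟶ tensorOver A M N :=
  coequalizer.π _ _

lemma tensorOver.condition (A M N : C) [MonObj A] [ModObj A M] [ModObj A N] :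
    rightAct A M ▷ N ≫ tensorOver.π A M N =
      (α_ M A N).hom ≫ M ◁ γ[A, N] ≫ tensorOver.π A M N :=
  (coequalizer.condition _ _).trans (Category.assoc _ _ _)

/-- The symmetry `M ⊗_A N ⟶ N ⊗_A M`, induced by that of `C`. -/
def tensorOver.swap (A M N : C) [MonObj A] [ModObj A M] [ModObj A N] :
    tensorOver A M N ⟶ tensorOver A N M :=
  coequalizer.desc ((β_ M N).hom ≫ tensorOver.π A N M) (by
    have h₁ : N ◁ γ[A, M] ≫ tensorOver.π A N M =
        (α_ N A M).inv ≫ (β_ N A).hom ▷ M ≫ γ[A, N] ▷ M ≫ tensorOver.π A N M := by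
      rw [← comp_whiskerRight_assoc, ← rightAct, tensorOver.condition, Iso.inv_hom_id_assoc]
    have h₂ : (β_ (M ⊗ A) N).hom ≫ N ◁ (β_ M A).hom ≫ (α_ N A M).inv ≫ (β_ N A).hom ▷ M =
        (α_ M A N).hom ≫ (β_ M (A ⊗ N)).hom := by
      rw [← BraidedCategory.braiding_naturality_left_assoc]
      simp [BraidedCategory.braiding_tensor_left_hom, BraidedCategory.braiding_tensor_right_hom,
        ← comp_whiskerRight]
    calc _ = (β_ (M ⊗ A) N).hom ≫ N ◁ (β_ M A).hom ≫ N ◁ γ[A, M] ≫ tensorOver.π A N M := by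
          rw [BraidedCategory.braiding_naturality_left_assoc, rightAct]
          simp
      _ = (α_ M A N).hom ≫ (β_ M (A ⊗ N)).hom ≫ γ[A, N] ▷ M ≫ tensorOver.π A N M := by
          rw [h₁, ← Category.assoc (α_ M A N).hom, ← h₂]
          simp only [Category.assoc]
      _ = _ := by
          rw [Category.assoc, ← BraidedCategory.braiding_naturality_right_assoc])

lemma tensorOver.hom_ext {A M N : C} [MonObj A] [ModObj A M] [ModObj A N] {Z : C}
    {f g : tensorOver A M N ⟶ Z} (h : tensorOver.π A M N ≫ f = tensorOver.π A M N ≫ g) : f = g :=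
  coequalizer.hom_ext h

lemma tensorOver.π_swap (A M N : C) [MonObj A] [ModObj A M] [ModObj A N] :
    tensorOver.π A M N ≫ tensorOver.swap A M N = (β_ M N).hom ≫ tensorOver.π A N M :=
  coequalizer.π_desc _ _

/-- The second symmetric power `S²_A(M)`: the coinvariants of the symmetry on `M ⊗_A M`. -/
def symSq (A M : C) [MonObj A] [ModObj A M] : C :=
  coequalizer (𝟙 (tensorOver A M M)) (tensorOver.swap A M M)

end SymmetricSquare

section Mu

variable [Abelian C]

/-- The augmentation ideal `H⁺ = Ker ε`. -/
def augIdeal (H : C) [ComonObj H] : C := kernel ε[H]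

/-- The inclusion `H⁺ ⟶ H`. -/
def augIdeal.incl (H : C) [ComonObj H] : augIdeal H ⟶ H := kernel.ι ε[H]

instance (H : C) [ComonObj H] : Mono (augIdeal.incl H) :=
  inferInstanceAs (Mono (kernel.ι ε[H]))

lemma augIdeal.incl_counit (H : C) [ComonObj H] : augIdeal.incl H ≫ ε[H] = 0 :=
  kernel.condition _

variable [SymmetricCategory C] [MonoidalPreadditive C]

/-- The action of `H` on `H⁺`, the restriction of the product of `H`. -/
def augIdeal.act (H : C) [BimonObj H] : H ⊗ augIdeal H ⟶ augIdeal H :=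
  kernel.lift ε[H] (H ◁ augIdeal.incl H ≫ μ[H]) (by
    rw [Category.assoc, Bimon.mul_counit, tensorHom_def', ← Category.assoc, ← Category.assoc,
      ← MonoidalCategory.whiskerLeft_comp, augIdeal.incl_counit]
    simp)

lemma augIdeal.act_incl (H : C) [BimonObj H] :
    augIdeal.act H ≫ augIdeal.incl H = H ◁ augIdeal.incl H ≫ μ[H] :=
  kernel.lift_ι _ _ _

/-- `H⁺` as an `H`-module. -/
instance augIdeal.modObj (H : C) [BimonObj H] : ModObj H (augIdeal H) where
  smul := augIdeal.act H
  one_smul := by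
    rw [← cancel_mono (augIdeal.incl H)]
    change (η[H] ▷ augIdeal H ≫ augIdeal.act H) ≫ _ = (λ_ (augIdeal H)).hom ≫ _
    rw [Category.assoc, augIdeal.act_incl, ← whisker_exchange_assoc, MonObj.one_mul]
    simp
  mul_smul := by
    rw [← cancel_mono (augIdeal.incl H)]
    change (μ[H] ▷ augIdeal H ≫ augIdeal.act H) ≫ _ =
      ((α_ H H (augIdeal H)).hom ≫ H ◁ augIdeal.act H ≫ augIdeal.act H) ≫ _
    simp only [Category.assoc, augIdeal.act_incl]
    rw [← MonoidalCategory.whiskerLeft_comp_assoc, augIdeal.act_incl, ← whisker_exchange_assoc,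
      MonObj.mul_assoc]
    simp

/-- The product `H⁺ ⊗ H⁺ ⟶ H⁺`, the restriction of the product of `H`. -/
def augIdeal.mul (H : C) [BimonObj H] : augIdeal H ⊗ augIdeal H ⟶ augIdeal H :=
  augIdeal.incl H ▷ augIdeal H ≫ augIdeal.act H

lemma augIdeal.mul_incl (H : C) [BimonObj H] :
    augIdeal.mul H ≫ augIdeal.incl H = (augIdeal.incl H ⊗ₘ augIdeal.incl H) ≫ μ[H] := by
  rw [augIdeal.mul, Category.assoc, augIdeal.act_incl, MonoidalCategory.tensorHom_def, Category.assoc]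

variable (H : C) [BimonObj H] [IsCommMonObj H]

/-- The morphism `H⁺ ⊗_H H⁺ ⟶ H⁺` induced by the product. -/
def augIdeal.mulOver : tensorOver H (augIdeal H) (augIdeal H) ⟶ augIdeal H :=
  coequalizer.desc (augIdeal.mul H) (by
    have h : rightAct H (augIdeal H) ≫ augIdeal.incl H = augIdeal.incl H ▷ H ≫ μ[H] := by
      change ((β_ (augIdeal H) H).hom ≫ augIdeal.act H) ≫ _ = _
      rw [Category.assoc, augIdeal.act_incl, ← BraidedCategory.braiding_naturality_left_assoc,
        IsCommMonObj.mul_comm]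
    rw [← cancel_mono (augIdeal.incl H)]
    simp only [Category.assoc, augIdeal.mul_incl]
    calc _ = ((rightAct H (augIdeal H) ≫ augIdeal.incl H) ⊗ₘ augIdeal.incl H) ≫ μ[H] := by
          simp [MonoidalCategory.tensorHom_def]
      _ = ((augIdeal.incl H ⊗ₘ 𝟙 H) ⊗ₘ augIdeal.incl H) ≫ μ[H] ▷ H ≫ μ[H] := by
          rw [h, tensorHom_id, ← tensorHom_id μ[H], tensorHom_comp_tensorHom_assoc,
            Category.comp_id]
      _ = (α_ _ _ _).hom ≫ (augIdeal.incl H ⊗ₘ (augIdeal.act H ≫ augIdeal.incl H)) ≫ μ[H] := by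
          rw [MonObj.mul_assoc, augIdeal.act_incl, associator_naturality_assoc]
          simp [MonoidalCategory.tensorHom_def]
      _ = _ := by
          change _ = (α_ _ _ _).hom ≫ augIdeal H ◁ augIdeal.act H ≫ _
          simp [MonoidalCategory.tensorHom_def'])

lemma augIdeal.π_mulOver :
    tensorOver.π H (augIdeal H) (augIdeal H) ≫ augIdeal.mulOver H = augIdeal.mul H :=
  coequalizer.π_desc _ _

/-- The morphism `μ_H : S²_H(H⁺) ⟶ H⁺` induced by the product. -/
def muHom : symSq H (augIdeal H) ⟶ augIdeal H :=
  coequalizer.desc (augIdeal.mulOver H) (by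
    apply tensorOver.hom_ext
    rw [Category.id_comp, ← Category.assoc, tensorOver.π_swap, Category.assoc,
      augIdeal.π_mulOver]
    rw [← cancel_mono (augIdeal.incl H), Category.assoc, augIdeal.mul_incl,
      ← BraidedCategory.braiding_naturality_assoc, IsCommMonObj.mul_comm])

end Mu

end HopfSmooth

end

noncomputable section

/-! ### Splitting in semisimple abelian categories. -/

namespace HopfSmooth

/-! Semisimplicity is used only through splitting: every epimorphism has a section and every
monomorphism a retraction, so the additive tensor product preserves exactness. The conditions are
linked in the cycle (a) ⇒ (d) ⇒ (b) ⇒ (c) ⇒ (a). Write h⁺ = h - ε(h).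

(a) ⇒ (d), `mono_muHom_of_isSmooth`: the class of h⁺ ⊗ k⁺ in V = S²_H(H⁺) is a symmetric 2-cocycle,
with H acting on V through ε. It gives a commutative square zero extension of H by V. An algebra
section has a V-component sending hk to the class of h ⊗ k for h, k in H⁺, which is a retraction of
μ_H.

(d) ⇒ (b): if lifts of f(H⁺) kill the kernel of R → S, products of such lifts define a morphism
S²_H(H⁺) → R, and a retraction of μ_H corrects a linear lift of f to a multiplicative one
(`exists_lift_of_mono_muHom`). For any square zero kernel K this applies modulo J = K·f(H⁺) and
gives g' : H → R/J, not necessarily colinear. Now K is a Hopf module through f, so K ≅ K/J ⊗ H;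
hence there is a unique g over f whose image in R/J ⊗ H is h ↦ g'(h₁) ⊗ h₂, and uniqueness makes g
multiplicative and colinear (`exists_comodAlgHom_lift_of_isSquareZero`). Nilpotent kernels follow by
induction on the exponent (`exists_comodAlgHom_lift_of_mulPow`).

(b) ⇒ (c), `ofHom_isSmooth`: the functor - □_Q H turns a lifting problem over Q into one over H;
coflatness keeps the quotient morphism epic, and the counit of H brings the lift back. (c) ⇒ (a),
`isSmooth_of_ofHom_isSmooth`: take Q = 𝟙. -/

lemma splitEpiCategory_of_isSemisimpleCategory {C : Type u} [Category.{v} C] [Abelian C]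
    (hC : IsSemisimpleCategory C) : SplitEpiCategory C where
  isSplitEpi_of_epi {X Y} p hp := by
    -- As `Y` is a coproduct of simples, it is enough to lift morphisms from simple objects.
    have key : ∀ (T : C) (_ : Simple T) (y : T ⟶ Y), ∃ x : T ⟶ X, x ≫ p = y := by
      intro T hT y
      obtain ⟨J, S, c, hS, ⟨hc⟩, ⟨e⟩⟩ := hC (pullback y p)
      -- The pullback maps epimorphically to `T ≠ 0`, so one of its simple summands maps
      -- nontrivially, hence isomorphically by Schur's lemma.
      have : ∃ j, c.inj j ≫ e.hom ≫ pullback.fst y p ≠ 0 := by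
        by_contra! h
        have h0 : e.hom ≫ pullback.fst y p = 0 :=
          Cofan.IsColimit.hom_ext hc _ _ fun j => by rw [h, comp_zero]
        have h1 : pullback.fst y p = 0 := by
          rw [← cancel_epi e.hom, h0, comp_zero]
        have := hT
        have : 𝟙 T = 0 := by
          rw [← cancel_epi (pullback.fst y p), h1, zero_comp, zero_comp]
        exact id_nonzero T this
      obtain ⟨j, hj⟩ := this
      have := hS j
      have := isIso_of_hom_simple hj
      refine ⟨inv (c.inj j ≫ e.hom ≫ pullback.fst y p) ≫ c.inj j ≫ e.hom ≫ pullback.snd y p, ?_⟩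
      simp only [Category.assoc, IsIso.inv_comp_eq, pullback.condition]
    obtain ⟨J, S, c, hS, ⟨hc⟩, ⟨e⟩⟩ := hC Y
    choose x hx using fun j => key (S j) (hS j) (c.inj j ≫ e.hom)
    exact IsSplitEpi.mk' ⟨e.inv ≫ Cofan.IsColimit.desc hc x, by
      rw [Category.assoc, Iso.inv_comp_eq, Category.comp_id]
      refine Cofan.IsColimit.hom_ext hc _ _ fun j => ?_
      rw [Cofan.IsColimit.fac_assoc, hx]⟩

variable {C : Type u} [Category.{v} C]

section SplitExact

/-- A sequence `X ⟶ Y ⟶ Z` with a contracting homotopy at `Y`. -/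
structure SplitExact [Preadditive C] {X Y Z : C} (f : X ⟶ Y) (g : Y ⟶ Z) : Prop where
  zero : f ≫ g = 0
  exists_homotopy : ∃ (s : Y ⟶ X) (t : Z ⟶ Y), s ≫ f + g ≫ t = 𝟙 Y

lemma SplitExact.exists_lift [Preadditive C] {W X Y Z : C} {f : X ⟶ Y} {g : Y ⟶ Z}
    (h : SplitExact f g) (y : W ⟶ Y) (hy : y ≫ g = 0) : ∃ x : W ⟶ X, x ≫ f = y := by
  obtain ⟨s, t, e⟩ := h.exists_homotopy
  refine ⟨y ≫ s, ?_⟩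
  have := congrArg (y ≫ ·) e
  simpa [reassoc_of% hy] using this

lemma SplitExact.whiskerRight [Preadditive C] [MonoidalCategory C] [MonoidalPreadditive C]
    {X Y Z : C} {f : X ⟶ Y} {g : Y ⟶ Z} (h : SplitExact f g) (W : C) :
    SplitExact (f ▷ W) (g ▷ W) := by
  obtain ⟨s, t, e⟩ := h.exists_homotopy
  refine ⟨by rw [← comp_whiskerRight, h.zero, MonoidalPreadditive.zero_whiskerRight],
    s ▷ W, t ▷ W, ?_⟩
  rw [← comp_whiskerRight, ← comp_whiskerRight, ← MonoidalPreadditive.add_whiskerRight, e,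
    id_whiskerRight]

lemma exists_section [SplitEpiCategory C] {X Y : C} (p : X ⟶ Y) [Epi p] :
    ∃ s : Y ⟶ X, s ≫ p = 𝟙 Y :=
  have := isSplitEpi_of_epi p
  ⟨section_ p, IsSplitEpi.id p⟩

lemma epi_tensorHom [SplitEpiCategory C] [MonoidalCategory C] {X Y X' Y' : C}
    (p : X ⟶ Y) (p' : X' ⟶ Y') [Epi p] [Epi p'] : Epi (p ⊗ₘ p') := by
  obtain ⟨s, hs⟩ := exists_section p
  obtain ⟨s', hs'⟩ := exists_section p'
  exact epi_of_epi_fac (f := s ⊗ₘ s') (g := p ⊗ₘ p') (h := 𝟙 _)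
    (by rw [tensorHom_comp_tensorHom, hs, hs', id_tensorHom_id])

variable [Abelian C] [SplitEpiCategory C]

lemma splitExact_kernel {X Y : C} (p : X ⟶ Y) [Epi p] : SplitExact (kernel.ι p) p := by
  obtain ⟨s, hs⟩ := exists_section p
  exact ⟨kernel.condition p, kernel.lift p (𝟙 X - p ≫ s) (by simp [hs]), s, by simp⟩

lemma splitExact_cokernel {X Y : C} (j : X ⟶ Y) : SplitExact j (cokernel.π j) := by
  obtain ⟨s, hs⟩ := exists_section (cokernel.π j)
  have h := (ShortComplex.exact_cokernel j).epi_kernelLift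
  obtain ⟨t, ht⟩ := exists_section (kernel.lift (cokernel.π j) j (cokernel.condition j))
  refine ⟨cokernel.condition j,
    kernel.lift (cokernel.π j) (𝟙 Y - cokernel.π j ≫ s) (by simp [hs]) ≫ t, s, ?_⟩
  have := congrArg (· ≫ kernel.ι (cokernel.π j)) ht
  simp only [Category.assoc, kernel.lift_ι, Category.id_comp] at this
  rw [Category.assoc, this]
  simp

lemma exists_retraction {X Y : C} (i : X ⟶ Y) [Mono i] : ∃ r : Y ⟶ X, i ≫ r = 𝟙 X := by
  obtain ⟨s, t, e⟩ := (splitExact_cokernel i).exists_homotopy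
  refine ⟨s, ?_⟩
  rw [← cancel_mono i]
  have := congrArg (i ≫ ·) e
  simpa using this

/-- Factor `d` as an epimorphism with a section followed by a monomorphism with a retraction; the
complement of the section lifts through `e`, and this lift is half of the homotopy. -/
lemma splitExact_of_exists_lift {X Y Z : C} (e : X ⟶ Y) (d : Y ⟶ Z) (h : e ≫ d = 0)
    (hl : ∀ {W : C} (y : W ⟶ Y), y ≫ d = 0 → ∃ x, x ≫ e = y) : SplitExact e d := by
  obtain ⟨I, p, m, _, _, rfl⟩ : ∃ (I : C) (p : Y ⟶ I) (m : I ⟶ Z), Epi p ∧ Mono m ∧ p ≫ m = d :=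
    ⟨image d, factorThruImage d, image.ι d, inferInstance, inferInstance, image.fac d⟩
  obtain ⟨s, hs⟩ := exists_section p
  obtain ⟨r, hr⟩ := exists_retraction m
  obtain ⟨l, hl⟩ := hl (𝟙 Y - p ≫ s) (by simp [reassoc_of% hs])
  exact ⟨h, l, r ≫ s, by rw [hl, Category.assoc, reassoc_of% hr, sub_add_cancel]⟩

lemma mono_whiskerRight [MonoidalCategory C] {X Y : C} (i : X ⟶ Y) [Mono i] (W : C) :
    Mono (i ▷ W) := by
  obtain ⟨r, hr⟩ := exists_retraction i
  exact mono_of_mono_fac (show i ▷ W ≫ r ▷ W = 𝟙 _ by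
    rw [← comp_whiskerRight, hr, id_whiskerRight])

end SplitExact

/-! ### Products of generalized elements of an algebra. -/

variable [MonoidalCategory C]

/-- The external product `X ⊗ Y ⟶ T` of two morphisms to an algebra `T`. -/
def extMul {X Y T : C} [MonObj T] (a : X ⟶ T) (b : Y ⟶ T) : X ⊗ Y ⟶ T := (a ⊗ₘ b) ≫ μ[T]

local infix:70 "⋆" => extMul

section ExternalProduct

variable {X Y Z W X' Y' T U : C} [MonObj T] [MonObj U]

lemma tensorHom_extMul (x : X' ⟶ X) (y : Y' ⟶ Y) (a : X ⟶ T) (b : Y ⟶ T) :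
    (x ⊗ₘ y) ≫ (a ⋆ b) = (x ≫ a) ⋆ (y ≫ b) := by
  simp [extMul]

lemma whiskerRight_extMul (x : X' ⟶ X) (a : X ⟶ T) (b : Y ⟶ T) :
    x ▷ Y ≫ (a ⋆ b) = (x ≫ a) ⋆ b := by
  simp [extMul, MonoidalCategory.tensorHom_def]

lemma whiskerLeft_extMul (y : Y' ⟶ Y) (a : X ⟶ T) (b : Y ⟶ T) :
    X ◁ y ≫ (a ⋆ b) = a ⋆ (y ≫ b) := by
  simp [extMul, MonoidalCategory.tensorHom_def']

lemma extMul_comp (a : X ⟶ T) (b : Y ⟶ T) (φ : T ⟶ U) [IsMonHom φ] :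
    (a ⋆ b) ≫ φ = (a ≫ φ) ⋆ (b ≫ φ) := by
  simp [extMul, IsMonHom.mul_hom]

lemma id_extMul_id : 𝟙 T ⋆ 𝟙 T = μ[T] := by simp [extMul]

lemma extMul_assoc (a : X ⟶ T) (b : Y ⟶ T) (c : Z ⟶ T) :
    (a ⋆ b) ⋆ c = (α_ X Y Z).hom ≫ (a ⋆ (b ⋆ c)) := by
  have h₁ : (a ⋆ b) ⋆ c = ((a ⊗ₘ b) ⊗ₘ c) ≫ μ[T] ▷ T ≫ μ[T] := by
    rw [extMul, extMul, ← tensorHom_id, tensorHom_comp_tensorHom_assoc, Category.comp_id]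
  have h₂ : a ⋆ (b ⋆ c) = (a ⊗ₘ (b ⊗ₘ c)) ≫ T ◁ μ[T] ≫ μ[T] := by
    rw [extMul, extMul, ← id_tensorHom, tensorHom_comp_tensorHom_assoc, Category.comp_id]
  rw [h₁, h₂, MonObj.mul_assoc, associator_naturality_assoc]

@[simp]
lemma extMul_one (a : X ⟶ T) : a ⋆ η[T] = (ρ_ X).hom ≫ a := by
  simp [extMul, MonoidalCategory.tensorHom_def]

@[simp]
lemma one_extMul (a : X ⟶ T) : η[T] ⋆ a = (λ_ X).hom ≫ a := by
  simp [extMul, MonoidalCategory.tensorHom_def']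

section Preadditive

variable [Preadditive C] [MonoidalPreadditive C]

@[simp]
lemma zero_extMul (b : Y ⟶ T) : (0 : X ⟶ T) ⋆ b = 0 := by simp [extMul]

@[simp]
lemma extMul_zero (a : X ⟶ T) : a ⋆ (0 : Y ⟶ T) = 0 := by simp [extMul]

lemma add_extMul (a a' : X ⟶ T) (b : Y ⟶ T) : (a + a') ⋆ b = a ⋆ b + a' ⋆ b := by
  simp [extMul, MonoidalPreadditive.add_tensor]

lemma extMul_add (a : X ⟶ T) (b b' : Y ⟶ T) : a ⋆ (b + b') = a ⋆ b + a ⋆ b' := by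
  simp [extMul, MonoidalPreadditive.tensor_add]

lemma sub_extMul (a a' : X ⟶ T) (b : Y ⟶ T) : (a - a') ⋆ b = a ⋆ b - a' ⋆ b := by
  rw [eq_sub_iff_add_eq, ← add_extMul, sub_add_cancel]

lemma extMul_sub (a : X ⟶ T) (b b' : Y ⟶ T) : a ⋆ (b - b') = a ⋆ b - a ⋆ b' := by
  rw [eq_sub_iff_add_eq, ← extMul_add, sub_add_cancel]

end Preadditive

section Braided

variable [BraidedCategory C]

lemma extMul_comm [IsCommMonObj T] (a : X ⟶ T) (b : Y ⟶ T) :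
    a ⋆ b = (β_ X Y).hom ≫ (b ⋆ a) := by
  rw [extMul, extMul, ← BraidedCategory.braiding_naturality_assoc, IsCommMonObj.mul_comm]

lemma tensorHom_extMul_tensorHom (a : X ⟶ T) (b : Y ⟶ U) (c : Z ⟶ T) (d : W ⟶ U) :
    (a ⊗ₘ b) ⋆ (c ⊗ₘ d) = tensorμ X Y Z W ≫ ((a ⋆ c) ⊗ₘ (b ⋆ d)) := by
  simp only [extMul]
  rw [MonObj.tensorObj.mul_def, tensorμ_natural_assoc, tensorHom_comp_tensorHom]

end Braided

lemma extMul_extMul_extMul_comm [SymmetricCategory C] [IsCommMonObj T] (a : X ⟶ T) (b : Y ⟶ T)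
    (c : Z ⟶ T) (d : W ⟶ T) :
    (a ⋆ b) ⋆ (c ⋆ d) = tensorμ X Y Z W ≫ ((a ⋆ c) ⋆ (b ⋆ d)) := by
  have h (a : X ⟶ T) (b : Y ⟶ T) (c : Z ⟶ T) (d : W ⟶ T) :
      (a ⋆ b) ⋆ (c ⋆ d) = ((a ⊗ₘ b) ⊗ₘ (c ⊗ₘ d)) ≫ (μ[T] ⊗ₘ μ[T]) ≫ μ[T] := by
    simp only [extMul, tensorHom_comp_tensorHom_assoc]
  have h' : (a ⋆ c) ⋆ (b ⋆ d) = ((a ⊗ₘ c) ⊗ₘ (b ⊗ₘ d)) ≫ (μ[T] ⊗ₘ μ[T]) ≫ μ[T] := by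
    simp only [extMul, tensorHom_comp_tensorHom_assoc]
  rw [h, h', ← tensorμ_natural_assoc, MonObj.mul_mul_mul_comm]

end ExternalProduct

/-! ### The augmentation ideal and its symmetric square. -/

section Augmentation

variable [SymmetricCategory C] (H : C) [BimonObj H]

lemma mul_counit_one : μ[H] ≫ ε[H] ≫ η[H] = (ε[H] ≫ η[H]) ⋆ (ε[H] ≫ η[H]) := by
  rw [← tensorHom_extMul, one_extMul, Bimon.mul_counit_assoc]

variable [Abelian C]

/-- The projection `h ↦ h - ε(h)` onto the augmentation ideal. -/
def augProj : H ⟶ augIdeal H :=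
  kernel.lift ε[H] (𝟙 H - ε[H] ≫ η[H]) (by simp)

lemma augProj_incl : augProj H ≫ augIdeal.incl H = 𝟙 H - ε[H] ≫ η[H] :=
  kernel.lift_ι _ _ _

@[simp]
lemma one_augProj : η[H] ≫ augProj H = 0 := by
  rw [← cancel_mono (augIdeal.incl H), Category.assoc, augProj_incl]
  simp

@[simp]
lemma incl_augProj : augIdeal.incl H ≫ augProj H = 𝟙 _ := by
  rw [← cancel_mono (augIdeal.incl H), Category.assoc, augProj_incl]
  simp [reassoc_of% augIdeal.incl_counit H]

variable [MonoidalPreadditive C]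

/-- Expand (h⁺ + ε(h))(k⁺ + ε(k)) - ε(h)ε(k). This identity drives both the cocycle condition and
the multiplicativity of the lifts. -/
lemma mul_augProj : μ[H] ≫ augProj H = (augProj H ⊗ₘ augProj H) ≫ augIdeal.mul H +
    (ε[H] ⊗ₘ augProj H) ≫ (λ_ _).hom + (augProj H ⊗ₘ ε[H]) ≫ (ρ_ _).hom := by
  have h₁ : ((ε[H] ⊗ₘ augProj H) ≫ (λ_ _).hom) ≫ augIdeal.incl H =
      (ε[H] ≫ η[H]) ⋆ (𝟙 H - ε[H] ≫ η[H]) := by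
    rw [← augProj_incl, ← tensorHom_extMul, one_extMul, Category.assoc]
  have h₂ : ((augProj H ⊗ₘ ε[H]) ≫ (ρ_ _).hom) ≫ augIdeal.incl H =
      (𝟙 H - ε[H] ≫ η[H]) ⋆ (ε[H] ≫ η[H]) := by
    rw [← augProj_incl, ← tensorHom_extMul, extMul_one, Category.assoc]
  have h₃ : ((augProj H ⊗ₘ augProj H) ≫ augIdeal.mul H) ≫ augIdeal.incl H =
      (𝟙 H - ε[H] ≫ η[H]) ⋆ (𝟙 H - ε[H] ≫ η[H]) := by
    rw [Category.assoc, augIdeal.mul_incl, tensorHom_comp_tensorHom_assoc, augProj_incl, extMul]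
  rw [← cancel_mono (augIdeal.incl H), Preadditive.add_comp, Preadditive.add_comp, h₁, h₂, h₃,
    Category.assoc, augProj_incl, Preadditive.comp_sub, Category.comp_id, mul_counit_one,
    ← id_extMul_id]
  simp only [extMul_sub, sub_extMul]
  abel

variable {H} [IsCommMonObj H]

lemma rightAct_incl :
    rightAct H (augIdeal H) ≫ augIdeal.incl H = augIdeal.incl H ⋆ 𝟙 H := by
  change ((β_ (augIdeal H) H).hom ≫ augIdeal.act H) ≫ _ = _
  rw [Category.assoc, augIdeal.act_incl, extMul_comm, extMul, id_tensorHom]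

end Augmentation

section SymSq

variable [SymmetricCategory C] [HasCoequalizers C]

/-- The projection `M ⊗_A M ⟶ S²_A(M)`. -/
def symSq.π (A M : C) [MonObj A] [ModObj A M] : tensorOver A M M ⟶ symSq A M :=
  coequalizer.π _ _

lemma symSq.swap_π (A M : C) [MonObj A] [ModObj A M] :
    tensorOver.swap A M M ≫ symSq.π A M = symSq.π A M :=
  (coequalizer.condition _ _).symm.trans (Category.id_comp _)

lemma symSq.hom_ext {A M : C} [MonObj A] [ModObj A M] {Z : C} {f g : symSq A M ⟶ Z}
    (h : symSq.π A M ≫ f = symSq.π A M ≫ g) : f = g :=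
  coequalizer.hom_ext h

end SymSq

lemma symSq.π_muHom [Abelian C] [SymmetricCategory C] [MonoidalPreadditive C] (H : C)
    [BimonObj H] [IsCommMonObj H] :
    symSq.π H (augIdeal H) ≫ muHom H = augIdeal.mulOver H :=
  coequalizer.π_desc _ _

/-! ### Lifting algebra morphisms when the kernel is killed by f(H⁺). -/

section TrivialExtension

variable [Abelian C] [SplitEpiCategory C] [SymmetricCategory C] [MonoidalPreadditive C]
  {H : C} [BimonObj H] [IsCommMonObj H]

/-- If `μ_H` is monic, then algebra morphisms `f : H ⟶ S` lift along algebra epimorphisms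
`R ⟶ S` whose kernel is annihilated by the preimage of `f(H⁺)`. -/
theorem exists_lift_of_mono_muHom [Mono (muHom H)] {R S : C} [MonObj R] [IsCommMonObj R]
    [MonObj S] (π : R ⟶ S) [IsMonHom π] [Epi π] (f : H ⟶ S) [IsMonHom f]
    (triv : ∀ {X Y : C} (k : X ⟶ R) (w : Y ⟶ R) (w' : Y ⟶ H), k ≫ π = 0 → w ≫ π = w' ≫ f →
      w' ≫ ε[H] = 0 → k ⋆ w = 0) :
    ∃ g : H ⟶ R, IsMonHom g ∧ g ≫ π = f := by
  obtain ⟨τ, hτ⟩ := exists_section π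
  obtain ⟨σ, hσ⟩ : ∃ σ : H ⟶ R, σ ≫ π = f := ⟨f ≫ τ, by simp [hτ]⟩
  -- Next to a factor lying over f(H⁺), the choice of a lift does not matter. Thus `σ` behaves
  -- multiplicatively inside such products, and `m` below is balanced over `H`.
  have indep {X Y : C} (a a' : X ⟶ R) (b : Y ⟶ R) (b' : Y ⟶ H) (ha : a ≫ π = a' ≫ π)
      (hb : b ≫ π = b' ≫ f) (hb' : b' ≫ ε[H] = 0) : a ⋆ b = a' ⋆ b := by
    rw [← sub_eq_zero, ← sub_extMul]
    exact triv _ b b' (by rw [Preadditive.sub_comp, ha, sub_self]) hb hb'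
  have indep' {X Y : C} (a a' : X ⟶ R) (b : Y ⟶ R) (b' : Y ⟶ H) (ha : a ≫ π = a' ≫ π)
      (hb : b ≫ π = b' ≫ f) (hb' : b' ≫ ε[H] = 0) : b ⋆ a = b ⋆ a' := by
    rw [extMul_comm, extMul_comm b, indep a a' b b' ha hb hb']
  let i := augIdeal.incl H
  have hi : i ≫ ε[H] = 0 := augIdeal.incl_counit H
  have hiσ : (i ≫ σ) ≫ π = i ≫ f := by rw [Category.assoc, hσ]
  let m : augIdeal H ⊗ augIdeal H ⟶ R := (i ≫ σ) ⋆ (i ≫ σ)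
  have hact : augIdeal.act H ≫ i = 𝟙 H ⋆ i := by
    rw [augIdeal.act_incl, extMul, id_tensorHom]
  have hm : rightAct H (augIdeal H) ▷ augIdeal H ≫ m =
      ((α_ _ H _).hom ≫ augIdeal H ◁ γ[H, augIdeal H]) ≫ m := by
    change _ = ((α_ _ H _).hom ≫ augIdeal H ◁ augIdeal.act H) ≫ m
    rw [Category.assoc, whiskerRight_extMul, whiskerLeft_extMul,
      indep (rightAct H (augIdeal H) ≫ i ≫ σ) ((i ≫ σ) ⋆ σ) (i ≫ σ) i _ hiσ hi,
      indep' (augIdeal.act H ≫ i ≫ σ) (σ ⋆ (i ≫ σ)) (i ≫ σ) i _ hiσ hi, extMul_assoc]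
    · rw [extMul_comp, hiσ, hσ, Category.assoc, Category.assoc, hσ, reassoc_of% hact, extMul_comp,
        Category.id_comp]
    · rw [extMul_comp, hiσ, hσ, Category.assoc, Category.assoc, hσ, ← Category.assoc,
        rightAct_incl, extMul_comp, Category.id_comp]
  let m₁ : tensorOver H (augIdeal H) (augIdeal H) ⟶ R := coequalizer.desc m hm
  have hm₁ : tensorOver.π H (augIdeal H) (augIdeal H) ≫ m₁ = m := coequalizer.π_desc _ _
  let m₂ : symSq H (augIdeal H) ⟶ R := coequalizer.desc m₁ (by
    apply tensorOver.hom_ext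
    rw [Category.id_comp, ← Category.assoc, tensorOver.π_swap, Category.assoc, hm₁]
    exact extMul_comm _ _)
  let q := symSq.π H (augIdeal H)
  have hm₂ : q ≫ m₂ = m₁ := coequalizer.π_desc _ _
  have hq : q ≫ muHom H = augIdeal.mulOver H := symSq.π_muHom H
  have hm₂π : m₂ ≫ π = muHom H ≫ i ≫ f := by
    apply symSq.hom_ext
    rw [reassoc_of% hm₂, reassoc_of% hq]
    apply tensorOver.hom_ext
    rw [reassoc_of% hm₁, ← Category.assoc, augIdeal.π_mulOver, ← Category.assoc,
      augIdeal.mul_incl, extMul_comp, hiσ]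
    exact (extMul_comp i i f).symm
  obtain ⟨t, ht⟩ := exists_retraction (muHom H)
  -- The defect `m₂ - muHom H ≫ i ≫ σ` takes values in the kernel of `π`; extending it to H⁺ by the
  -- retraction `t` corrects `i ≫ σ` without changing its image in `S`.
  let s : augIdeal H ⟶ R := i ≫ σ + t ≫ (m₂ - muHom H ≫ i ≫ σ)
  have hsπ : s ≫ π = i ≫ f := by
    simp [s, hm₂π, hσ]
  have hs : muHom H ≫ s = m₂ := by
    simp [s, reassoc_of% ht]
  have hss : s ⋆ s = augIdeal.mul H ≫ s := by
    rw [indep s (i ≫ σ) s i (by rw [hsπ, hiσ]) hsπ hi,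
      indep' s (i ≫ σ) (i ≫ σ) i (by rw [hsπ, hiσ]) hiσ hi, ← augIdeal.π_mulOver, ← hq,
      Category.assoc, Category.assoc, hs, hm₂, hm₁]
  refine ⟨ε[H] ≫ η[R] + augProj H ≫ s, ⟨?_, ?_⟩, ?_⟩
  · simp [reassoc_of% one_augProj H]
  · change _ = _ ⋆ _
    rw [Preadditive.comp_add, ← Category.assoc μ[H] (augProj H), mul_augProj]
    simp only [add_extMul, extMul_add, Preadditive.add_comp, Category.assoc, ← tensorHom_extMul,
      hss, one_extMul, extMul_one, Bimon.mul_counit_assoc, unitors_equal]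
    abel
  · rw [Preadditive.add_comp, Category.assoc, Category.assoc, hsπ, reassoc_of% augProj_incl]
    simp

end TrivialExtension

/-! ### The commutative algebra extension defined by a symmetric 2-cocycle. -/

section CocycleExtension

/-- The product of a scalar with a morphism. -/
def scalarMul {X Y V : C} (s : X ⟶ 𝟙_ C) (v : Y ⟶ V) : X ⊗ Y ⟶ V := (s ⊗ₘ v) ≫ (λ_ V).hom

/-- The product of a morphism with a scalar. -/
def mulScalar {X Y V : C} (v : X ⟶ V) (s : Y ⟶ 𝟙_ C) : X ⊗ Y ⟶ V := (v ⊗ₘ s) ≫ (ρ_ V).hom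

variable {X Y Z V W : C}

lemma scalarMul_scalarMul (s : X ⟶ 𝟙_ C) (t : Y ⟶ 𝟙_ C) (v : Z ⟶ V) :
    scalarMul (scalarMul s t) v = (α_ _ _ _).hom ≫ scalarMul s (scalarMul t v) := by
  simp [scalarMul, MonoidalCategory.tensorHom_def]

lemma mulScalar_scalarMul (s : X ⟶ 𝟙_ C) (v : Y ⟶ V) (t : Z ⟶ 𝟙_ C) :
    mulScalar (scalarMul s v) t = (α_ _ _ _).hom ≫ scalarMul s (mulScalar v t) := by
  simp only [scalarMul, mulScalar, MonoidalCategory.tensorHom_def]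
  monoidal

lemma mulScalar_mulScalar (v : X ⟶ V) (s : Y ⟶ 𝟙_ C) (t : Z ⟶ 𝟙_ C) :
    mulScalar (mulScalar v s) t = (α_ _ _ _).hom ≫ mulScalar v (scalarMul s t) := by
  simp [scalarMul, mulScalar, MonoidalCategory.tensorHom_def, unitors_equal]

lemma tensorHom_scalarMul (x : X ⟶ W) (y : Y ⟶ Z) (s : W ⟶ 𝟙_ C) (v : Z ⟶ V) :
    (x ⊗ₘ y) ≫ scalarMul s v = scalarMul (x ≫ s) (y ≫ v) := by
  simp [scalarMul]

lemma tensorHom_mulScalar (x : X ⟶ W) (y : Y ⟶ Z) (v : W ⟶ V) (s : Z ⟶ 𝟙_ C) :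
    (x ⊗ₘ y) ≫ mulScalar v s = mulScalar (x ≫ v) (y ≫ s) := by
  simp [mulScalar]

lemma scalarMul_tensorHom_comp {X' Y' : C} (s : X ⟶ 𝟙_ C) (v : Y ⟶ X') (w : Z ⟶ Y')
    (f : X' ⊗ Y' ⟶ V) :
    (scalarMul s v ⊗ₘ w) ≫ f = (α_ _ _ _).hom ≫ scalarMul s ((v ⊗ₘ w) ≫ f) := by
  simp only [scalarMul, MonoidalCategory.tensorHom_def]
  monoidal

lemma mulScalar_tensorHom {X' Y' : C} (v : X ⟶ X') (s : Y ⟶ 𝟙_ C) (w : Z ⟶ Y') :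
    (mulScalar v s ⊗ₘ w) = (α_ _ _ _).hom ≫ (v ⊗ₘ scalarMul s w) := by
  simp only [scalarMul, mulScalar, MonoidalCategory.tensorHom_def]
  monoidal

lemma mulScalar_tensorHom_comp {X' Y' : C} (v : X ⟶ X') (w : Y ⟶ Y') (s : Z ⟶ 𝟙_ C)
    (f : X' ⊗ Y' ⟶ V) :
    mulScalar ((v ⊗ₘ w) ≫ f) s = (α_ _ _ _).hom ≫ (v ⊗ₘ mulScalar w s) ≫ f := by
  have h : mulScalar ((v ⊗ₘ w) ≫ f) s = mulScalar (v ⊗ₘ w) s ≫ f := by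
    simp only [mulScalar, MonoidalCategory.tensorHom_def', comp_whiskerRight, Category.assoc,
      rightUnitor_naturality, rightUnitor_naturality_assoc]
  rw [h, ← Category.assoc]
  congr 1
  simp only [mulScalar, MonoidalCategory.tensorHom_def]
  monoidal

section Preadditive

variable [Preadditive C] [MonoidalPreadditive C]

lemma scalarMul_add (s : X ⟶ 𝟙_ C) (v v' : Y ⟶ V) :
    scalarMul s (v + v') = scalarMul s v + scalarMul s v' := by
  simp [scalarMul, MonoidalPreadditive.tensor_add]

lemma add_mulScalar (v v' : X ⟶ V) (s : Y ⟶ 𝟙_ C) :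
    mulScalar (v + v') s = mulScalar v s + mulScalar v' s := by
  simp [mulScalar, MonoidalPreadditive.add_tensor]

end Preadditive

variable [Abelian C] [SymmetricCategory C] {H : C} [BimonObj H]

/-- Normalized symmetric 2-cocycles of `H` with values in a trivial module. -/
structure IsSymmCocycle (F : H ⊗ H ⟶ V) : Prop where
  one_left : η[H] ▷ H ≫ F = 0
  symm : (β_ H H).hom ≫ F = F
  cocycle : μ[H] ▷ H ≫ F + mulScalar F ε[H] =
    (α_ H H H).hom ≫ (H ◁ μ[H] ≫ F + scalarMul ε[H] F)

/-- The second component of the product of the algebra extension given by `F`. -/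
def cocycleExt.mulSnd (F : H ⊗ H ⟶ V) : (H ⊞ V) ⊗ (H ⊞ V) ⟶ V :=
  (biprod.fst ⊗ₘ biprod.fst) ≫ F + scalarMul (biprod.fst ≫ ε[H]) biprod.snd +
    mulScalar biprod.snd (biprod.fst ≫ ε[H])

lemma cocycleExt.tensorHom_mulSnd (F : H ⊗ H ⟶ V) (x : X ⟶ H ⊞ V) (y : Y ⟶ H ⊞ V) :
    (x ⊗ₘ y) ≫ mulSnd F = ((x ≫ biprod.fst) ⊗ₘ (y ≫ biprod.fst)) ≫ F +
      scalarMul (x ≫ biprod.fst ≫ ε[H]) (y ≫ biprod.snd) +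
      mulScalar (x ≫ biprod.snd) (y ≫ biprod.fst ≫ ε[H]) := by
  simp [mulSnd, tensorHom_scalarMul, tensorHom_mulScalar]

variable [MonoidalPreadditive C]

/-- The algebra structure on `H ⊞ V` given by a cocycle. -/
@[reducible]
def cocycleExt {F : H ⊗ H ⟶ V} (hF : IsSymmCocycle F) : MonObj (H ⊞ V) where
  one := biprod.lift η[H] 0
  mul := biprod.lift (biprod.fst ⋆ biprod.fst) (cocycleExt.mulSnd F)
  one_mul := by
    ext
    · simp [whiskerRight_extMul]
    · rw [Category.assoc, biprod.lift_snd, ← tensorHom_id, cocycleExt.tensorHom_mulSnd]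
      simp only [biprod.lift_fst, biprod.lift_snd, biprod.lift_fst_assoc, Category.id_comp]
      rw [MonoidalCategory.tensorHom_def', Category.assoc, hF.one_left]
      simp [scalarMul, mulScalar]
  mul_one := by
    ext
    · simp [whiskerLeft_extMul]
    · rw [Category.assoc, biprod.lift_snd, ← id_tensorHom, cocycleExt.tensorHom_mulSnd]
      simp only [biprod.lift_fst, biprod.lift_snd, biprod.lift_fst_assoc, Category.id_comp]
      have : H ◁ η[H] ≫ F = 0 := by
        rw [← hF.symm, BraidedCategory.braiding_naturality_right_assoc, hF.one_left, comp_zero]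
      rw [MonoidalCategory.tensorHom_def, Category.assoc, this]
      simp [scalarMul, mulScalar]
  mul_assoc := by
    ext
    · simp [whiskerLeft_extMul, whiskerRight_extMul, extMul_assoc]
    · simp only [Category.assoc, biprod.lift_snd]
      rw [← tensorHom_id, ← id_tensorHom, cocycleExt.tensorHom_mulSnd,
        cocycleExt.tensorHom_mulSnd]
      simp only [biprod.lift_fst, biprod.lift_snd, biprod.lift_fst_assoc, Category.id_comp]
      let p : H ⊞ V ⟶ H := biprod.fst
      let r : H ⊞ V ⟶ V := biprod.snd
      have hε : (p ⋆ p) ≫ ε[H] = scalarMul (p ≫ ε[H]) (p ≫ ε[H]) := by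
        rw [extMul, Category.assoc, Bimon.mul_counit, ← Category.assoc, tensorHom_comp_tensorHom,
          scalarMul]
      have e₁ : ((p ⋆ p) ⊗ₘ p) ≫ F = ((p ⊗ₘ p) ⊗ₘ p) ≫ μ[H] ▷ H ≫ F := by
        rw [extMul, ← tensorHom_id, tensorHom_comp_tensorHom_assoc, Category.comp_id]
      have e₂ : (p ⊗ₘ (p ⋆ p)) ≫ F = (p ⊗ₘ p ⊗ₘ p) ≫ H ◁ μ[H] ≫ F := by
        rw [extMul, ← id_tensorHom, tensorHom_comp_tensorHom_assoc, Category.comp_id]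
      have e₃ : mulScalar ((p ⊗ₘ p) ≫ F) (p ≫ ε[H]) = ((p ⊗ₘ p) ⊗ₘ p) ≫ mulScalar F ε[H] := by
        rw [tensorHom_mulScalar]
      have e₄ : scalarMul (p ≫ ε[H]) ((p ⊗ₘ p) ≫ F) = (p ⊗ₘ p ⊗ₘ p) ≫ scalarMul ε[H] F := by
        rw [tensorHom_scalarMul]
      -- The terms linear in the V-components agree by associativity of scalar multiplication; the
      -- remaining terms are the cocycle identity on the H-components.
      have key := congrArg (((p ⊗ₘ p) ⊗ₘ p) ≫ ·) hF.cocycle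
      simp only [Preadditive.comp_add, associator_naturality_assoc] at key
      change ((p ⋆ p) ⊗ₘ p) ≫ F + scalarMul ((p ⋆ p) ≫ ε[H]) r +
        mulScalar ((p ⊗ₘ p) ≫ F + scalarMul (p ≫ ε[H]) r + mulScalar r (p ≫ ε[H])) (p ≫ ε[H]) =
        (α_ _ _ _).hom ≫ ((p ⊗ₘ (p ⋆ p)) ≫ F +
          scalarMul (p ≫ ε[H]) ((p ⊗ₘ p) ≫ F + scalarMul (p ≫ ε[H]) r + mulScalar r (p ≫ ε[H])) +
          mulScalar r ((p ⋆ p) ≫ ε[H]))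
      simp only [hε, scalarMul_add, add_mulScalar, Preadditive.comp_add, e₁, e₂, e₃, e₄,
        scalarMul_scalarMul, mulScalar_scalarMul, mulScalar_mulScalar]
      rw [← sub_eq_zero] at key ⊢
      rw [← key]
      abel

lemma isCommMonObj_cocycleExt {F : H ⊗ H ⟶ V} [IsCommMonObj H] (hF : IsSymmCocycle F) :
    letI := cocycleExt hF
    IsCommMonObj (H ⊞ V) :=
  letI := cocycleExt hF
  { mul_comm := by
      change (β_ _ _).hom ≫ biprod.lift (biprod.fst ⋆ biprod.fst) (cocycleExt.mulSnd F) =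
        biprod.lift (biprod.fst ⋆ biprod.fst) (cocycleExt.mulSnd F)
      ext
      · rw [Category.assoc, biprod.lift_fst, ← extMul_comm]
      · simp only [Category.assoc, biprod.lift_snd, cocycleExt.mulSnd, Preadditive.comp_add,
          scalarMul, mulScalar, ← BraidedCategory.braiding_naturality_assoc, hF.symm]
        simp only [braiding_leftUnitor, braiding_rightUnitor]
        abel }

end CocycleExtension

section Nilpotent

lemma isNilpotentIdeal_of_extMul_self_eq_zero [HasZeroMorphisms C] {I R : C} [MonObj R]
    (i : I ⟶ R) (h : ∀ {X Y : C} (x : X ⟶ I) (y : Y ⟶ I), (x ≫ i) ⋆ (y ≫ i) = 0) :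
    IsNilpotentIdeal i := by
  refine ⟨2, ?_⟩
  have h₁ : mulPow i 1 = (λ_ I).hom ≫ i := one_extMul i
  change mulPow i 1 ⋆ i = 0
  rw [h₁]
  exact (congrArg _ (Category.id_comp i).symm).trans (h (λ_ I).hom (𝟙 I))

end Nilpotent

/-! ### Smoothness makes μ_H monic. -/

section SmoothImpliesMono

variable [Abelian C] [SymmetricCategory C] [MonoidalPreadditive C]
  (H : C) [BimonObj H]

/-- The projection `H⁺ ⊗ H⁺ ⟶ S²_H(H⁺)`. -/
def symSqProj : augIdeal H ⊗ augIdeal H ⟶ symSq H (augIdeal H) :=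
  tensorOver.π H (augIdeal H) (augIdeal H) ≫ symSq.π H (augIdeal H)

lemma braiding_symSqProj : (β_ _ _).hom ≫ symSqProj H = symSqProj H := by
  rw [symSqProj, ← Category.assoc, ← tensorOver.π_swap, Category.assoc, symSq.swap_π]

variable [IsCommMonObj H]

lemma symSqProj_muHom : symSqProj H ≫ muHom H = augIdeal.mul H := by
  rw [symSqProj, Category.assoc, symSq.π_muHom, augIdeal.π_mulOver]

/-- The relation xh ⊗ y = x ⊗ hy of the tensor product over `H`, for h in H⁺. -/
lemma mul_whiskerRight_symSqProj :
    augIdeal.mul H ▷ augIdeal H ≫ symSqProj H =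
      (α_ _ _ _).hom ≫ augIdeal H ◁ augIdeal.mul H ≫ symSqProj H := by
  have h : augIdeal.mul H = augIdeal H ◁ augIdeal.incl H ≫ rightAct H (augIdeal H) := by
    rw [← cancel_mono (augIdeal.incl H), augIdeal.mul_incl, Category.assoc, rightAct_incl,
      whiskerLeft_extMul, Category.comp_id, extMul]
  have h' := tensorOver.condition H (augIdeal H) (augIdeal H)
  change _ = (α_ _ _ _).hom ≫ _ ◁ augIdeal.act H ≫ _ at h'
  conv_lhs => rw [h]
  rw [symSqProj, comp_whiskerRight, Category.assoc, reassoc_of% h', augIdeal.mul]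
  simp

/-- Expand (hk)⁺ and (kl)⁺ by `mul_augProj`. The terms containing ε cancel, leaving h⁺k⁺ ⊗ l⁺ = h⁺ ⊗
k⁺l⁺, which is `mul_whiskerRight_symSqProj`. -/
lemma isSymmCocycle_symSqProj :
    IsSymmCocycle ((augProj H ⊗ₘ augProj H) ≫ symSqProj H) where
  one_left := by
    rw [← tensorHom_id, tensorHom_comp_tensorHom_assoc, one_augProj]
    simp
  symm := by
    rw [← BraidedCategory.braiding_naturality_assoc, braiding_symSqProj]
  cocycle := by
    have h := mul_augProj H
    change _ = _ + scalarMul _ _ + mulScalar _ _ at h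
    rw [← tensorHom_id, tensorHom_comp_tensorHom_assoc, h, ← id_tensorHom,
      tensorHom_comp_tensorHom_assoc, h]
    simp only [Category.id_comp, MonoidalPreadditive.add_tensor, MonoidalPreadditive.tensor_add,
      Preadditive.add_comp, Preadditive.comp_add, scalarMul_tensorHom_comp, mulScalar_tensorHom,
      mulScalar_tensorHom_comp, Category.assoc]
    have h₁ : ((augProj H ⊗ₘ augProj H) ≫ augIdeal.mul H ⊗ₘ augProj H) ≫ symSqProj H =
        (α_ _ _ _).hom ≫ (augProj H ⊗ₘ (augProj H ⊗ₘ augProj H) ≫ augIdeal.mul H) ≫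
          symSqProj H := by
      have := congrArg (((augProj H ⊗ₘ augProj H) ⊗ₘ augProj H) ≫ ·)
        (mul_whiskerRight_symSqProj H)
      simpa only [← tensorHom_id, ← id_tensorHom, tensorHom_comp_tensorHom_assoc,
        Category.comp_id, associator_naturality_assoc] using this
    rw [h₁]
    abel

theorem mono_muHom_of_isSmooth (h : IsSmooth H) : Mono (muHom H) := by
  have hF := isSymmCocycle_symSqProj H
  let V := symSq H (augIdeal H)
  let _ := cocycleExt hF
  have := isCommMonObj_cocycleExt hF
  have hη : η[H ⊞ V] = biprod.lift η[H] 0 := rfl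
  have hμ : μ[H ⊞ V] = biprod.lift (biprod.fst ⋆ biprod.fst)
    (cocycleExt.mulSnd ((augProj H ⊗ₘ augProj H) ≫ symSqProj H)) := rfl
  have hfst : IsMonHom (biprod.fst : H ⊞ V ⟶ H) :=
    ⟨by rw [hη, biprod.lift_fst], by rw [hμ, biprod.lift_fst]; rfl⟩
  have hmul {X Y : C} (x : X ⟶ H ⊞ V) (y : Y ⟶ H ⊞ V) : (x ⋆ y) ≫ biprod.snd =
      ((x ≫ biprod.fst) ⊗ₘ (y ≫ biprod.fst)) ≫ (augProj H ⊗ₘ augProj H) ≫ symSqProj H +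
      scalarMul (x ≫ biprod.fst ≫ ε[H]) (y ≫ biprod.snd) +
      mulScalar (x ≫ biprod.snd) (y ≫ biprod.fst ≫ ε[H]) := by
    rw [extMul, hμ, Category.assoc, biprod.lift_snd, cocycleExt.tensorHom_mulSnd]
  -- The kernel `V` has square zero: the cocycle sees only H-components, and `H` acts on `V` through
  -- ε.
  obtain ⟨g, hg, hgp⟩ := h (H ⊞ V) H biprod.fst
    (isNilpotentIdeal_of_extMul_self_eq_zero _ fun x y => by
      ext
      · simp [extMul_comp]
      · rw [hmul]
        simp [scalarMul, mulScalar]) (𝟙 H)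
  have hgσ : μ[H] ≫ g = g ⋆ g := IsMonHom.mul_hom g
  -- On H⁺ ⊗ H⁺ the two scalar terms of the product vanish, so the V-component of g(hk) is the
  -- cocycle itself.
  have key : augIdeal.mul H ≫ augIdeal.incl H ≫ g ≫ biprod.snd = symSqProj H := by
    rw [← Category.assoc, augIdeal.mul_incl, Category.assoc, reassoc_of% hgσ, hmul, hgp,
      reassoc_of% hgp]
    simp [scalarMul, mulScalar, augIdeal.incl_counit]
  have hs : muHom H ≫ augIdeal.incl H ≫ g ≫ biprod.snd = 𝟙 _ := by
    apply symSq.hom_ext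
    apply tensorOver.hom_ext
    rw [← Category.assoc, ← symSqProj, ← Category.assoc, symSqProj_muHom, key, Category.comp_id,
      symSqProj]
  exact mono_of_mono_fac hs

end SmoothImpliesMono

/-! ### Tensor products and quotients of algebras. -/

section TensorAlgebra

variable (T U : C) [MonObj T] [MonObj U]

lemma isMonHom_one : IsMonHom η[T] where
  mul_hom := by
    change _ = η[T] ⋆ η[T]
    simp [unitors_equal]

variable [BraidedCategory C]

/-- The algebra morphism `t ↦ t ⊗ 1`. -/
def tensorInl : T ⟶ T ⊗ U := (ρ_ T).inv ≫ T ◁ η[U]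

/-- The algebra morphism `u ↦ 1 ⊗ u`. -/
def tensorInr : U ⟶ T ⊗ U := (λ_ U).inv ≫ η[T] ▷ U

instance : IsMonHom (tensorInl T U) := by
  have := isMonHom_one U
  unfold tensorInl
  infer_instance

instance : IsMonHom (tensorInr T U) := by
  have := isMonHom_one T
  unfold tensorInr
  infer_instance

variable {T U} {X Y Z : C}

lemma tensorHom_eq_extMul (a : X ⟶ T) (b : Y ⟶ U) :
    a ⊗ₘ b = (a ≫ tensorInl T U) ⋆ (b ≫ tensorInr T U) := by
  have h : tensorInl T U ⋆ tensorInr T U = 𝟙 (T ⊗ U) := by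
    have h₁ : tensorInl T U = (ρ_ T).inv ≫ (𝟙 T ⊗ₘ η[U]) := by rw [id_tensorHom, tensorInl]
    have h₂ : tensorInr T U = (λ_ U).inv ≫ (η[T] ⊗ₘ 𝟙 U) := by rw [tensorHom_id, tensorInr]
    rw [h₁, h₂, ← tensorHom_extMul, tensorHom_extMul_tensorHom, extMul_one, one_extMul]
    simp only [Category.comp_id, tensorμ, braiding_tensorUnit_left]
    monoidal
  rw [← tensorHom_extMul, h, Category.comp_id]

lemma tensorHom_extMul_tensorInr (a : X ⟶ T) (b : Y ⟶ U) (c : Z ⟶ U) :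
    (a ⊗ₘ b) ⋆ (c ≫ tensorInr T U) = (α_ X Y Z).hom ≫ (a ⊗ₘ (b ⋆ c)) := by
  rw [tensorHom_eq_extMul, tensorHom_eq_extMul, extMul_assoc, extMul_comp]

end TensorAlgebra

section Quotient

variable [SplitEpiCategory C]

lemma isMonHom_of_epi_comp {R R' S : C} [MonObj R] [MonObj R'] [MonObj S] (c : R ⟶ R') [Epi c]
    [IsMonHom c] (π : R' ⟶ S) (h : IsMonHom (c ≫ π)) : IsMonHom π where
  one_hom := by rw [← IsMonHom.one_hom c, Category.assoc, IsMonHom.one_hom]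
  mul_hom := by
    have : Epi (c ⊗ₘ c) := epi_tensorHom _ _
    rw [← cancel_epi (c ⊗ₘ c), ← IsMonHom.mul_hom_assoc c, IsMonHom.mul_hom,
      tensorHom_comp_tensorHom_assoc]

variable [BraidedCategory C]

/-- The quotient of an algebra by an ideal. -/
lemma exists_monObj_quotient [Preadditive C] [MonoidalPreadditive C] {R R' : C} [MonObj R]
    [IsCommMonObj R] (c : R ⟶ R') [Epi c]
    (hc : ∀ {X Y : C} (x : X ⟶ R) (y : Y ⟶ R), x ≫ c = 0 → (x ⋆ y) ≫ c = 0) :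
    ∃ _ : MonObj R', IsCommMonObj R' ∧ IsMonHom c := by
  obtain ⟨τ, hτ⟩ := exists_section c
  have hx {X Y : C} (x x' : X ⟶ R) (y : Y ⟶ R) (h : x ≫ c = x' ≫ c) :
      (x ⋆ y) ≫ c = (x' ⋆ y) ≫ c := by
    rw [← sub_eq_zero, ← Preadditive.sub_comp, ← sub_extMul]
    exact hc _ _ (by rw [Preadditive.sub_comp, h, sub_self])
  have hy {X Y : C} (x x' : X ⟶ R) (y : Y ⟶ R) (h : x ≫ c = x' ≫ c) :
      (y ⋆ x) ≫ c = (y ⋆ x') ≫ c := by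
    rw [extMul_comm, extMul_comm y, Category.assoc, hx x x' y h, Category.assoc]
  -- Multiply the representatives chosen by `τ`; `hx` and `hy` make the result independent of them.
  let m : R' ⊗ R' ⟶ R' := (τ ⋆ τ) ≫ c
  have hm {X Y : C} (x : X ⟶ R) (y : Y ⟶ R) : ((x ≫ c) ⊗ₘ (y ≫ c)) ≫ m = (x ⋆ y) ≫ c := by
    rw [reassoc_of% tensorHom_extMul, hx _ x _ (by simp [hτ]), hy _ y _ (by simp [hτ])]
  have hc₁ : Epi (𝟙 (𝟙_ C) ⊗ₘ c) := epi_tensorHom _ _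
  have hc₂ : Epi (c ⊗ₘ 𝟙 (𝟙_ C)) := epi_tensorHom _ _
  have hcc : Epi (c ⊗ₘ c) := epi_tensorHom _ _
  have hccc : Epi ((c ⊗ₘ c) ⊗ₘ c) := epi_tensorHom _ _
  let M : MonObj R' :=
    { one := η[R] ≫ c
      mul := m
      one_mul := by
        rw [← cancel_epi (𝟙 (𝟙_ C) ⊗ₘ c), ← tensorHom_id, tensorHom_comp_tensorHom_assoc,
          Category.id_comp, Category.comp_id]
        have := hm η[R] (𝟙 R)
        rw [Category.id_comp] at this
        simp [this]
      mul_one := by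
        rw [← cancel_epi (c ⊗ₘ 𝟙 (𝟙_ C)), ← id_tensorHom, tensorHom_comp_tensorHom_assoc,
          Category.id_comp, Category.comp_id]
        have := hm (𝟙 R) η[R]
        rw [Category.id_comp] at this
        simp [this]
      mul_assoc := by
        have h := hm (𝟙 R) (𝟙 R)
        simp only [Category.id_comp] at h
        have h₁ := hm (𝟙 R ⋆ 𝟙 R) (𝟙 R)
        have h₂ := hm (𝟙 R) (𝟙 R ⋆ 𝟙 R)
        rw [← h, Category.id_comp] at h₁ h₂
        rw [← cancel_epi ((c ⊗ₘ c) ⊗ₘ c), ← tensorHom_id, tensorHom_comp_tensorHom_assoc,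
          Category.comp_id, h₁, associator_naturality_assoc, ← id_tensorHom,
          tensorHom_comp_tensorHom_assoc, Category.comp_id, h₂, extMul_assoc, Category.assoc] }
  have hμ : μ[R'] = m := rfl
  have hcm : (c ⊗ₘ c) ≫ m = μ[R] ≫ c := by
    have h := hm (𝟙 R) (𝟙 R)
    rwa [Category.id_comp, id_extMul_id] at h
  refine ⟨M, ⟨?_⟩, ⟨rfl, ?_⟩⟩
  · rw [← cancel_epi (c ⊗ₘ c), hμ, BraidedCategory.braiding_naturality_assoc, hcm,
      IsCommMonObj.mul_comm_assoc]
  · rw [hμ, hcm]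


end Quotient

/-! ### Kernels of colinear epimorphisms. -/

section KernelComodule

variable [Abelian C] [SplitEpiCategory C] [MonoidalPreadditive C] {Q : C} [ComonObj Q]

lemma exists_kernel_coact {R S : RightComod Q} (π : R.X ⟶ S.X) [Epi π]
    (hπ : R.coact ≫ π ▷ Q = π ≫ S.coact) :
    ∃ r : kernel π ⟶ kernel π ⊗ Q, r ≫ kernel.ι π ▷ Q = kernel.ι π ≫ R.coact :=
  ((splitExact_kernel π).whiskerRight Q).exists_lift _ (by
    rw [Category.assoc, hπ, kernel.condition_assoc, zero_comp])

/-- The kernel of a colinear epimorphism as a comodule. -/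
def kernelComod {R S : RightComod Q} (π : R.X ⟶ S.X) [Epi π]
    (hπ : R.coact ≫ π ▷ Q = π ≫ S.coact) : RightComod Q where
  X := kernel π
  coact := (exists_kernel_coact π hπ).choose
  coact_counit := by
    have h := (exists_kernel_coact π hπ).choose_spec
    have := mono_whiskerRight (kernel.ι π) (𝟙_ C)
    rw [← cancel_mono (kernel.ι π ▷ 𝟙_ C), Category.assoc, whisker_exchange, reassoc_of% h,
      R.coact_counit, rightUnitor_inv_naturality]
  coact_comul := by
    have h := (exists_kernel_coact π hπ).choose_spec
    have := mono_whiskerRight (kernel.ι π) (Q ⊗ Q)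
    rw [← cancel_mono (kernel.ι π ▷ (Q ⊗ Q)), Category.assoc, whisker_exchange, reassoc_of% h,
      R.coact_comul]
    simp only [Category.assoc]
    rw [← associator_naturality_left, ← comp_whiskerRight_assoc, h, comp_whiskerRight_assoc,
      reassoc_of% h]

lemma kernelComod_coact {R S : RightComod Q} (π : R.X ⟶ S.X) [Epi π]
    (hπ : R.coact ≫ π ▷ Q = π ≫ S.coact) :
    (kernelComod π hπ).coact ≫ kernel.ι π ▷ Q = kernel.ι π ≫ R.coact :=
  (exists_kernel_coact π hπ).choose_spec

end KernelComodule

/-! ### Square zero extensions of comodule algebras. -/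

section SquareZero

open scoped HopfObj

section Antipode

variable [BraidedCategory C] {H R S : C} [HopfObj H] [MonObj R] [MonObj S] {π : R ⟶ S} {f : H ⟶ S}
  [IsMonHom π] [IsMonHom f]

lemma antipode_extMul (σ : H ⟶ R) (hσ : σ ≫ π = f) :
    (Δ[H] ≫ ((𝒮[H] ≫ σ) ⋆ σ)) ≫ π = ε[H] ≫ η[S] := by
  have := HopfObj.antipode_left H
  rw [Category.assoc, extMul_comp, Category.assoc, hσ, ← whiskerRight_extMul,
    ← Category.id_comp f, ← extMul_comp, id_extMul_id, reassoc_of% this, IsMonHom.one_hom]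

lemma extMul_antipode (σ : H ⟶ R) (hσ : σ ≫ π = f) :
    (Δ[H] ≫ (σ ⋆ (𝒮[H] ≫ σ))) ≫ π = ε[H] ≫ η[S] := by
  have := HopfObj.antipode_right H
  rw [Category.assoc, extMul_comp, Category.assoc, hσ, ← whiskerLeft_extMul,
    ← Category.id_comp f, ← extMul_comp, id_extMul_id, reassoc_of% this, IsMonHom.one_hom]

end Antipode

variable [Abelian C] [MonoidalPreadditive C]

/-- The kernel of `π` has square zero. -/
def IsSquareZero {R S : C} [MonObj R] (π : R ⟶ S) : Prop :=
  ∀ ⦃X Y : C⦄ (x : X ⟶ R) (y : Y ⟶ R), x ≫ π = 0 → y ≫ π = 0 → x ⋆ y = 0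

lemma IsSquareZero.extMul_congr {R S : C} [MonObj R] {π : R ⟶ S} (h : IsSquareZero π) {X Y : C}
    (x : X ⟶ R) (hx : x ≫ π = 0) {y y' : Y ⟶ R} (hy : y ≫ π = y' ≫ π) : x ⋆ y = x ⋆ y' := by
  rw [← sub_eq_zero, ← extMul_sub]
  exact h _ _ hx (by rw [Preadditive.sub_comp, hy, sub_self])

/-- The pair (π, ψ) is a monomorphism into a biproduct, hence split, and stays monic after
tensoring. This serves to check colinearity of the lift. -/
lemma eq_of_comp_eq_of_whiskerRight [SplitEpiCategory C] {R S B : C} (π : R ⟶ S) (ψ : R ⟶ B)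
    (h : ∀ {X : C} (x : X ⟶ R), x ≫ π = 0 → x ≫ ψ = 0 → x = 0) (U : C) {X : C}
    {x y : X ⟶ R ⊗ U} (hπ : x ≫ π ▷ U = y ≫ π ▷ U) (hψ : x ≫ ψ ▷ U = y ≫ ψ ▷ U) : x = y := by
  have : Mono (biprod.lift π ψ) := Preadditive.mono_of_cancel_zero _ fun x hx =>
    h x (by simpa using hx =≫ biprod.fst) (by simpa using hx =≫ biprod.snd)
  have := mono_whiskerRight (biprod.lift π ψ) U
  have e : biprod.lift π ψ = π ≫ biprod.inl + ψ ≫ biprod.inr := by ext <;> simp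
  rw [← cancel_mono (biprod.lift π ψ ▷ U), e, MonoidalPreadditive.add_whiskerRight,
    comp_whiskerRight, comp_whiskerRight, Preadditive.comp_add, Preadditive.comp_add,
    reassoc_of% hπ, reassoc_of% hψ]

variable [SymmetricCategory C]

lemma IsSquareZero.whiskerRight [SplitEpiCategory C] {R S : C} [MonObj R] {π : R ⟶ S} [Epi π]
    (h : IsSquareZero π) (U : C) [MonObj U] : IsSquareZero (π ▷ U) := by
  intro X Y x y hx hy
  have hs := (splitExact_kernel π).whiskerRight U
  obtain ⟨x', rfl⟩ := hs.exists_lift x hx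
  obtain ⟨y', rfl⟩ := hs.exists_lift y hy
  rw [← tensorHom_extMul, ← tensorHom_id, tensorHom_extMul_tensorHom,
    h _ _ (kernel.condition π) (kernel.condition π)]
  simp

variable {H : C} [HopfObj H] {R S : ComodAlg H} {π : R.X ⟶ S.X} {f : H ⟶ S.X}

/-- The morphism `x ↦ x₀ f(𝒮(x₁))`, in terms of a lift `σ` of `f`. -/
def coinvProj {K : C} (k : K ⟶ R.X) (r : K ⟶ K ⊗ H) (σ : H ⟶ R.X) : K ⟶ R.X :=
  r ≫ (k ⋆ (𝒮[H] ≫ σ))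

/-- Half of the Hopf module theorem: x₀ f(𝒮(x₁)) f(x₂) = x₀ ε(x₁) = x. Replacing `f` by its lift `σ`
is harmless next to elements of a square zero kernel. -/
lemma coact_coinvProj_extMul (hsq : IsSquareZero π) [IsMonHom π] [IsMonHom f] (K : RightComod H)
    (k : K.X ⟶ R.X) (hk : k ≫ π = 0) (σ : H ⟶ R.X) (hσ : σ ≫ π = f) :
    K.coact ≫ (coinvProj k K.coact σ ⋆ σ) = k := by
  have h : K.coact ≫ (coinvProj k K.coact σ ⋆ σ) =
      K.coact ≫ (k ⋆ (Δ[H] ≫ ((𝒮[H] ≫ σ) ⋆ σ))) := by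
    rw [coinvProj, ← whiskerRight_extMul, extMul_assoc, ← whiskerLeft_extMul,
      reassoc_of% K.coact_comul]
  rw [h, hsq.extMul_congr k hk (y' := ε[H] ≫ η[R.X]), ← whiskerLeft_extMul, ← Category.assoc,
    K.coact_counit]
  · simp
  · rw [antipode_extMul σ hσ, Category.assoc, IsMonHom.one_hom]

/-- For x in `K` and ε(h) = 0, the projection sends x f(h) to x₀ f(h₁) f(𝒮(x₁h₂)) = x₀ f(𝒮(x₁))
f(h₁𝒮(h₂)) = 0. Hence it kills K·f(H⁺). -/
lemma coinvProj_eq_zero [SplitEpiCategory C] [IsCommMonObj H] [Epi π] (hsq : IsSquareZero π)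
    (hπ : IsComodAlgHom R S π) [IsMonHom f] (hf : Δ[H] ≫ f ▷ H = f ≫ S.coact)
    (K : RightComod H) (k : K.X ⟶ R.X) (hk : k ≫ π = 0)
    (hr : K.coact ≫ k ▷ H = k ≫ R.coact) (σ : H ⟶ R.X) (hσ : σ ≫ π = f)
    {W : C} (i : W ⟶ H) (hi : i ≫ ε[H] = 0) (j : K.X ⊗ W ⟶ K.X) (hj : j ≫ k = k ⋆ (i ≫ σ)) :
    j ≫ coinvProj k K.coact σ = 0 := by
  have := hπ.isMonHom
  have h₁ : j ≫ coinvProj k K.coact σ =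
      ((k ≫ R.coact) ⋆ ((i ≫ σ) ≫ R.coact)) ≫ (𝟙 R.X ⋆ (𝒮[H] ≫ σ)) := by
    rw [← extMul_comp, ← hj, Category.assoc j, ← hr, Category.assoc, Category.assoc,
      whiskerRight_extMul,
      Category.comp_id, coinvProj]
  have h₂ : (k ≫ R.coact) ⋆ ((i ≫ σ) ≫ R.coact) =
      (K.coact ⊗ₘ (i ≫ Δ[H])) ≫ tensorμ K.X H H H ≫ ((k ⋆ σ) ⊗ₘ μ[H]) := by
    have e : (k ≫ R.coact) ≫ π ▷ H = 0 := by
      rw [Category.assoc, hπ.colinear, reassoc_of% hk, zero_comp]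
    rw [(hsq.whiskerRight H).extMul_congr _ e (y' := (i ≫ Δ[H]) ≫ σ ▷ H), ← hr,
      ← tensorHom_extMul, ← tensorHom_id, ← tensorHom_id, tensorHom_extMul_tensorHom,
      id_extMul_id]
    rw [Category.assoc, Category.assoc, Category.assoc, Category.assoc, hπ.colinear,
      ← comp_whiskerRight, hσ, reassoc_of% hσ, hf]
  -- By commutativity the antipode is multiplicative; agreement modulo the kernel suffices because
  -- the other factor lies in the kernel.
  have h₃ : (μ[H] ≫ 𝒮[H] ≫ σ) ≫ π = ((𝒮[H] ≫ σ) ⋆ (𝒮[H] ≫ σ)) ≫ π := by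
    have := HopfObj.mul_antipode H
    rw [extMul_comp, Category.assoc, Category.assoc, hσ, reassoc_of% this,
      IsCommMonObj.mul_comm_assoc, ← extMul_comp, extMul, Category.assoc]
  have h₄ : (k ⋆ σ) ≫ π = 0 := by rw [extMul_comp, hk, zero_extMul]
  have h₅ : (K.coact ≫ (k ⋆ (𝒮[H] ≫ σ))) ≫ π = 0 := by
    rw [Category.assoc, extMul_comp, hk, zero_extMul, comp_zero]
  rw [h₁, h₂]
  simp only [Category.assoc]
  rw [tensorHom_extMul, Category.comp_id, hsq.extMul_congr _ h₄ h₃, ← extMul_extMul_extMul_comm,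
    tensorHom_extMul, Category.assoc, hsq.extMul_congr _ h₅ (y' := 0), extMul_zero]
  have e := extMul_antipode σ (f := f) (π := π) hσ
  rw [Category.assoc, e, reassoc_of% hi, zero_comp, zero_comp]

/-- The other half of the Hopf module theorem. The element x₀ f(𝒮(x₁)) goes to [x₀] ⊗ x₁𝒮(x₂) = [x]
⊗ 1, and multiplying by f(h) then gives [x] ⊗ h, since f(H⁺) kills the image of `K` in `R'`. -/
lemma coinvProj_extMul_comp (hsq : IsSquareZero π) [IsMonHom f]
    (hπ : IsComodAlgHom R S π) (hf : Δ[H] ≫ f ▷ H = f ≫ S.coact)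
    (K : RightComod H) (k : K.X ⟶ R.X) (hk : k ≫ π = 0)
    (hr : K.coact ≫ k ▷ H = k ≫ R.coact) (σ : H ⟶ R.X) (hσ : σ ≫ π = f)
    {R' : C} [MonObj R'] (c : R.X ⟶ R') [IsMonHom c] (π' : R' ⟶ S.X) (hc : c ≫ π' = π)
    (hj : (k ⋆ (augIdeal.incl H ≫ σ)) ≫ c = 0)
    (hex : ∀ {X : C} (z : X ⟶ R' ⊗ H), z ≫ π' ▷ H = 0 → ∃ l, l ≫ (k ≫ c) ▷ H = z) :
    (coinvProj k K.coact σ ⋆ σ) ≫ R.coact ≫ c ▷ H = (k ≫ c) ▷ H := by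
  have := hπ.isMonHom
  have hkψ : k ≫ R.coact ≫ c ▷ H = K.coact ≫ (k ≫ c) ▷ H := by
    rw [← reassoc_of% hr, comp_whiskerRight]
  have key : ((k ≫ c) ▷ H) ⋆ (σ ≫ R.coact ≫ c ▷ H) = ((k ≫ c) ▷ H) ⋆ tensorInr R' H := by
    let y : H ⟶ R' := augProj H ≫ augIdeal.incl H ≫ σ ≫ c
    have hy : y ≫ π' = f - ε[H] ≫ η[S.X] := by
      simp only [y, Category.assoc, hc, hσ]
      rw [reassoc_of% augProj_incl, Preadditive.sub_comp, Category.id_comp, Category.assoc,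
        IsMonHom.one_hom]
    have hη : tensorInr R' H ≫ π' ▷ H = Δ[H] ≫ (ε[H] ≫ η[S.X]) ▷ H := by
      have h : η[R'] ≫ π' = η[S.X] := by
        rw [← IsMonHom.one_hom c, Category.assoc, hc, IsMonHom.one_hom]
      rw [tensorInr, Category.assoc, ← comp_whiskerRight, h, comp_whiskerRight,
        ComonObj.counit_comul_assoc]
    -- Modulo the kernel, the coaction of σ(h) is 1 ⊗ h + y(h₁) ⊗ h₂, where y(h) is the class of
    -- σ(h⁺). Multiplication by `K` kills the second term (`h₁`) and the error `l` (`h₂`).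
    obtain ⟨l, hl⟩ := hex (σ ≫ R.coact ≫ c ▷ H - tensorInr R' H - Δ[H] ≫ y ▷ H) (by
      have e : (σ ≫ R.coact ≫ c ▷ H) ≫ π' ▷ H = Δ[H] ≫ f ▷ H := by
        rw [Category.assoc, Category.assoc, ← comp_whiskerRight, hc, hπ.colinear,
          reassoc_of% hσ, hf]
      rw [Preadditive.sub_comp, Preadditive.sub_comp, e, hη, Category.assoc, ← comp_whiskerRight,
        hy, ← Preadditive.comp_sub, ← Preadditive.comp_sub]
      have e' : f ▷ H - (ε[H] ≫ η[S.X]) ▷ H = (f - ε[H] ≫ η[S.X]) ▷ H := by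
        rw [sub_eq_iff_eq_add, ← MonoidalPreadditive.add_whiskerRight, sub_add_cancel]
      rw [e', sub_self, comp_zero])
    have h₁ : ((k ≫ c) ▷ H) ⋆ (Δ[H] ≫ y ▷ H) = 0 := by
      have : (k ≫ c) ⋆ y = 0 := by
        have e : (k ≫ c) ⋆ y = (K.X ◁ augProj H ≫ (k ⋆ (augIdeal.incl H ≫ σ))) ≫ c := by
          rw [whiskerLeft_extMul, extMul_comp]
          simp [y]
        rw [e, Category.assoc, hj, comp_zero]
      rw [← whiskerLeft_extMul, ← tensorHom_id, ← tensorHom_id, tensorHom_extMul_tensorHom, this]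
      simp
    have h₂ : ((k ≫ c) ▷ H) ⋆ (l ≫ (k ≫ c) ▷ H) = 0 := by
      have : (k ≫ c) ⋆ (k ≫ c) = 0 := by
        rw [← extMul_comp, hsq k k hk hk, zero_comp]
      rw [← whiskerLeft_extMul, ← tensorHom_id, tensorHom_extMul_tensorHom, this]
      simp
    rw [hl, extMul_sub, extMul_sub, h₁, sub_zero, sub_eq_zero] at h₂
    exact h₂
  have hθ : coinvProj k K.coact σ ≫ R.coact ≫ c ▷ H = k ≫ c ≫ tensorInl R' H := by
    have e := HopfObj.antipode_right H
    have e' : 𝟙 H ⋆ 𝒮[H] = H ◁ 𝒮[H] ≫ μ[H] := by rw [extMul, id_tensorHom]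
    rw [coinvProj, Category.assoc, extMul_comp, hkψ, Category.assoc, ← whiskerRight_extMul,
      ← whiskerLeft_extMul, key, whiskerLeft_extMul, ← tensorHom_id (k ≫ c),
      tensorHom_extMul_tensorInr, ← reassoc_of% K.coact_comul, ← id_tensorHom,
      tensorHom_comp_tensorHom, e', e, Category.id_comp]
    have e'' : (k ≫ c) ⊗ₘ (ε[H] ≫ η[H]) = K.X ◁ ε[H] ≫ ((k ≫ c) ⊗ₘ η[H]) := by
      rw [← id_tensorHom, tensorHom_comp_tensorHom, Category.id_comp]
    rw [e'', reassoc_of% K.coact_counit, tensorInl, MonoidalCategory.tensorHom_def,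
      ← rightUnitor_inv_naturality_assoc]
    simp
  have hinl : k ≫ c ≫ tensorInl R' H = ((ρ_ _).inv ≫ K.X ◁ η[H]) ≫ (k ≫ c) ▷ H := by
    rw [Category.assoc, whisker_exchange, ← rightUnitor_inv_naturality_assoc, tensorInl]
    simp
  rw [extMul_comp, hθ, hinl, ← whiskerRight_extMul, key, whiskerRight_extMul, ← hinl,
    ← Category.id_comp (tensorInr R' H), ← Category.assoc k, ← tensorHom_eq_extMul, tensorHom_id]

/-- If `μ_H` is monic, then colinear algebra morphisms from `H` lift along square zero
extensions of comodule algebras. -/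
theorem exists_comodAlgHom_lift_of_isSquareZero [SplitEpiCategory C] [IsCommMonObj H]
    [Mono (muHom H)] [Epi π] (hsq : IsSquareZero π) (hπ : IsComodAlgHom R S π)
    (hf : IsComodAlgHom (ComodAlg.regular H) S f) :
    ∃ g : H ⟶ R.X, IsComodAlgHom (ComodAlg.regular H) R g ∧ g ≫ π = f := by
  have := hπ.isMonHom
  have : IsMonHom f := hf.isMonHom
  have hfc : Δ[H] ≫ f ▷ H = f ≫ S.coact := hf.colinear
  obtain ⟨τ, hτ⟩ := exists_section π
  obtain ⟨σ, hσ⟩ : ∃ σ : H ⟶ R.X, σ ≫ π = f := ⟨f ≫ τ, by rw [Category.assoc, hτ, Category.comp_id]⟩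
  let K := kernelComod (R := R.toRightComod) (S := S.toRightComod) π hπ.colinear
  let k : K.X ⟶ R.X := kernel.ι π
  have hk : k ≫ π = 0 := kernel.condition π
  have hkm : Mono k := inferInstanceAs (Mono (kernel.ι π))
  have hr : K.coact ≫ k ▷ H = k ≫ R.coact := kernelComod_coact _ _
  have lift {X : C} (x : X ⟶ R.X) (hx : x ≫ π = 0) : ∃ l : X ⟶ K.X, l ≫ k = x :=
    ⟨kernel.lift π x hx, kernel.lift_ι _ _ _⟩
  let i := augIdeal.incl H
  obtain ⟨j', hj'⟩ := lift (k ⋆ (i ≫ σ)) (by rw [extMul_comp, hk, zero_extMul])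
  -- The image of `j` is the ideal J = K·f(H⁺), and `j'` is `j` viewed as a morphism to `K`.
  let j := k ⋆ (i ≫ σ)
  let c := cokernel.π j
  have hjc : j ≫ c = 0 := cokernel.condition j
  have hjπ : j ≫ π = 0 := by rw [extMul_comp, hk, zero_extMul]
  let π' : cokernel j ⟶ S.X := cokernel.desc j π hjπ
  have hc : c ≫ π' = π := cokernel.π_desc _ _ _
  have : Epi π' := epi_of_epi_fac hc
  obtain ⟨_, _, hcm⟩ := exists_monObj_quotient c (fun x y hx => by
    obtain ⟨l, rfl⟩ := (splitExact_cokernel j).exists_lift x hx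
    obtain ⟨l', hl'⟩ := lift (k ⋆ y) (by rw [extMul_comp, hk, zero_extMul])
    have e : j ⋆ y = ((α_ _ _ _).hom ≫ K.X ◁ (β_ _ _).hom ≫ (α_ _ _ _).inv ≫ l' ▷ _) ≫ j := by
      simp only [Category.assoc, j]
      rw [whiskerRight_extMul, hl', extMul_assoc, extMul_assoc, Iso.inv_hom_id_assoc,
        whiskerLeft_extMul, ← extMul_comm]
    rw [← whiskerRight_extMul, e, Category.assoc, Category.assoc, hjc, comp_zero, comp_zero])
  have : IsMonHom π' := isMonHom_of_epi_comp c π' (by rw [hc]; infer_instance)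
  obtain ⟨s, hs⟩ := exists_section c
  have lift' {X : C} (x : X ⟶ cokernel j) (hx : x ≫ π' = 0) : ∃ l : X ⟶ K.X, l ≫ k ≫ c = x := by
    obtain ⟨l, hl⟩ := lift (x ≫ s) (by rw [← hc, Category.assoc, reassoc_of% hs, hx])
    exact ⟨l, by rw [reassoc_of% hl, hs, Category.comp_id]⟩
  obtain ⟨g', _, hg'⟩ := exists_lift_of_mono_muHom π' f (fun x w w' hx hw hw' => by
    obtain ⟨l, rfl⟩ := lift' x hx
    obtain ⟨l', hl'⟩ := lift' (w - w' ≫ σ ≫ c) (by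
      rw [Preadditive.sub_comp, Category.assoc, Category.assoc, hc, hσ, hw, sub_self])
    obtain ⟨w'', rfl⟩ : ∃ w'', w'' ≫ i = w' := ⟨kernel.lift _ w' hw', kernel.lift_ι _ _ _⟩
    have e : (k ≫ c) ⋆ (i ≫ σ ≫ c) = 0 := by
      rw [← Category.assoc i, ← extMul_comp, hjc]
    have e' : (k ≫ c) ⋆ (k ≫ c) = 0 := by
      rw [← extMul_comp, hsq k k hk hk, zero_comp]
    rw [← sub_add_cancel w ((w'' ≫ i) ≫ σ ≫ c), ← hl', extMul_add, ← tensorHom_extMul, e',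
      Category.assoc w'', ← tensorHom_extMul, e, comp_zero, comp_zero, add_zero])
  have hex {X : C} (z : X ⟶ cokernel j ⊗ H) (hz : z ≫ π' ▷ H = 0) :
      ∃ l : X ⟶ K.X ⊗ H, l ≫ (k ≫ c) ▷ H = z := by
    obtain ⟨l, hl⟩ := ((splitExact_kernel π).whiskerRight H).exists_lift (z ≫ s ▷ H) (by
      rw [← hc, comp_whiskerRight, Category.assoc, ← comp_whiskerRight_assoc, hs,
        id_whiskerRight, Category.id_comp, hz])
    refine ⟨l, ?_⟩
    change l ≫ (kernel.ι π ≫ c) ▷ H = z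
    rw [comp_whiskerRight, reassoc_of% hl, ← comp_whiskerRight, hs, id_whiskerRight,
      Category.comp_id]
  -- This factors through K/J ⊗ H, where it inverts the morphism K → K/J ⊗ H induced by the
  -- coaction.
  let κ : K.X ⊗ H ⟶ R.X := coinvProj k K.coact σ ⋆ σ
  have hκ₁ : K.coact ≫ κ = k := coact_coinvProj_extMul hsq K k hk σ hσ
  have hκ₂ : j' ▷ H ≫ κ = 0 := by
    rw [whiskerRight_extMul, coinvProj_eq_zero hsq hπ hfc K k hk hr σ hσ i
      (augIdeal.incl_counit H) j' hj', zero_extMul]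
  have hκ₃ : κ ≫ R.coact ≫ c ▷ H = (k ≫ c) ▷ H :=
    coinvProj_extMul_comp hsq hπ hfc K k hk hr σ hσ c π' hc hjc hex
  have hκπ : κ ≫ π = 0 := by
    rw [extMul_comp, coinvProj, Category.assoc, extMul_comp, hk, zero_extMul, comp_zero,
      zero_extMul]
  let ψ : R.X ⟶ cokernel j ⊗ H := R.coact ≫ c ▷ H
  -- If `ψ` kills y in `K`, the coaction of y lies in J ⊗ H, which `κ` kills; but `κ` recovers y
  -- from its coaction.
  have uniq {X : C} (x : X ⟶ R.X) (hx : x ≫ π = 0) (hx' : x ≫ ψ = 0) : x = 0 := by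
    obtain ⟨y, rfl⟩ := lift x hx
    obtain ⟨l, hl⟩ := ((splitExact_cokernel j).whiskerRight H).exists_lift
      ((y ≫ K.coact) ≫ k ▷ H) (by
        rw [Category.assoc, Category.assoc, reassoc_of% hr, ← Category.assoc y]
        exact hx')
    have := mono_whiskerRight k H
    have hl' : l ≫ j' ▷ H = y ≫ K.coact := by
      rw [← cancel_mono (k ▷ H), ← hl, Category.assoc, ← comp_whiskerRight, hj']
    rw [← hκ₁, ← Category.assoc, ← hl', Category.assoc, hκ₂, comp_zero]
  have uniq' {X : C} (x y : X ⟶ R.X) (hx : x ≫ π = y ≫ π) (hx' : x ≫ ψ = y ≫ ψ) : x = y := by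
    rw [← sub_eq_zero]
    exact uniq _ (by rw [Preadditive.sub_comp, hx, sub_self])
      (by rw [Preadditive.sub_comp, hx', sub_self])
  have hψπ : ψ ≫ π' ▷ H = π ≫ S.coact := by
    rw [Category.assoc, ← comp_whiskerRight, hc, hπ.colinear]
  -- The desired value of g ≫ ψ is h ↦ g'(h₁) ⊗ h₂. Its difference from σ ≫ ψ lies in K/J ⊗ H, and
  -- `κ` carries it back to a correction of `σ` in `K`.
  obtain ⟨z, hz⟩ := hex (Δ[H] ≫ g' ▷ H - σ ≫ ψ) (by
    rw [Preadditive.sub_comp, Category.assoc, Category.assoc, ← comp_whiskerRight, hg', hψπ,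
      reassoc_of% hσ, hfc, sub_self])
  let g : H ⟶ R.X := σ + z ≫ κ
  have hgπ : g ≫ π = f := by
    rw [Preadditive.add_comp, Category.assoc, hκπ, comp_zero, add_zero, hσ]
  have hgψ : g ≫ ψ = Δ[H] ≫ g' ▷ H := by
    rw [Preadditive.add_comp, Category.assoc, hκ₃, hz, add_sub_cancel]
  refine ⟨g, ⟨⟨?_, ?_⟩, ?_⟩, hgπ⟩
  · change η[H] ≫ g = η[R.X]
    apply uniq'
    · rw [Category.assoc, hgπ, IsMonHom.one_hom, IsMonHom.one_hom]
    · rw [Category.assoc, hgψ, IsMonHom.one_hom, IsMonHom.one_hom]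
  · change μ[H] ≫ g = g ⋆ g
    apply uniq'
    · rw [Category.assoc, hgπ, extMul_comp, hgπ, IsMonHom.mul_hom, extMul]
    · rw [Category.assoc, hgψ, extMul_comp, hgψ, IsMonHom.mul_hom, extMul]
  · change Δ[H] ≫ g ▷ H = g ≫ R.coact
    apply eq_of_comp_eq_of_whiskerRight π ψ uniq
    · rw [Category.assoc, Category.assoc, ← comp_whiskerRight, hgπ, hπ.colinear, reassoc_of% hgπ,
        hfc]
    · have e₁ : R.coact ≫ ψ ▷ H = ψ ≫ cokernel j ◁ Δ[H] ≫ (α_ _ _ _).inv := by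
        have := R.coact_comul
        rw [Category.assoc, ← whisker_exchange_assoc, reassoc_of% this, comp_whiskerRight]
        simp
      rw [Category.assoc, Category.assoc, ← comp_whiskerRight, hgψ, e₁, reassoc_of% hgψ,
        ← whisker_exchange_assoc, ComonObj.comul_assoc_assoc]
      simp

end SquareZero

/-! ### Powers of ideals. -/

section Powers

/-- The morphism of tensor powers induced by a morphism. -/
def tensorPowMap {I J : C} (l : I ⟶ J) : ∀ n : ℕ, tensorPow I n ⟶ tensorPow J n
  | 0 => 𝟙 _
  | n + 1 => tensorPowMap l n ⊗ₘ l

variable {I J R R' : C} [MonObj R] [MonObj R']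

lemma mulPow_zero (i : I ⟶ R) : mulPow i 0 = η[R] := rfl

lemma mulPow_succ (i : I ⟶ R) (n : ℕ) : mulPow i (n + 1) = mulPow i n ⋆ i := rfl

lemma mulPow_one (i : I ⟶ R) : mulPow i 1 = (λ_ I).hom ≫ i := one_extMul i

lemma tensorPowMap_mulPow (l : I ⟶ J) (i : J ⟶ R) (n : ℕ) :
    tensorPowMap l n ≫ mulPow i n = mulPow (l ≫ i) n := by
  induction n with
  | zero => exact Category.id_comp _
  | succ n ih =>
    rw [mulPow_succ, mulPow_succ, ← ih]
    exact tensorHom_extMul _ _ _ _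

lemma mulPow_comp (i : I ⟶ R) (φ : R ⟶ R') [IsMonHom φ] (n : ℕ) :
    mulPow i n ≫ φ = mulPow (i ≫ φ) n := by
  induction n with
  | zero => exact IsMonHom.one_hom φ
  | succ n ih =>
    rw [mulPow_succ, mulPow_succ, ← ih]
    exact extMul_comp _ _ _

/-- Collecting the factors from `U` shows that (I ⊗ U)ⁿ lies in Iⁿ ⊗ U. It makes powers of a
costable ideal costable and bounds the kernel after cotensoring. -/
lemma exists_mulPow_whiskerRight [BraidedCategory C] (i : I ⟶ R) (U : C) [MonObj U] (n : ℕ) :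
    ∃ s : tensorPow (I ⊗ U) n ⟶ tensorPow I n ⊗ U, mulPow (i ▷ U) n = s ≫ mulPow i n ▷ U := by
  induction n with
  | zero =>
    refine ⟨(λ_ (𝟙_ C)).inv ≫ 𝟙_ C ◁ η[U], ?_⟩
    rw [mulPow_zero, mulPow_zero, MonObj.tensorObj.one_def, MonoidalCategory.tensorHom_def']
    exact (Category.assoc _ _ _).symm
  | succ n ih =>
    obtain ⟨s, hs⟩ := ih
    refine ⟨s ▷ (I ⊗ U) ≫ tensorμ _ _ _ _ ≫ _ ◁ μ[U], ?_⟩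
    have e : (s ≫ mulPow i n ▷ U) ⋆ (i ▷ U) =
        (s ▷ (I ⊗ U) ≫ tensorμ _ _ _ _ ≫ _ ◁ μ[U]) ≫ (mulPow i n ⋆ i) ▷ U := by
      rw [← whiskerRight_extMul, ← tensorHom_id (mulPow i n), ← tensorHom_id i,
        tensorHom_extMul_tensorHom, id_extMul_id, MonoidalCategory.tensorHom_def']
      simp only [Category.assoc]
    rw [mulPow_succ, hs]
    exact e

lemma mulPow_succ_eq_zero [Preadditive C] [MonoidalPreadditive C] (i : I ⟶ R)
    {n : ℕ} (h : mulPow i n = 0) : mulPow i (n + 1) = 0 := by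
  rw [mulPow_succ, h]
  exact zero_extMul i

end Powers

/-! ### Quotients by costable ideals and nilpotent extensions. -/

section Quotient

variable [SplitEpiCategory C] [BraidedCategory C] {Q : C} [BimonObj Q]

/-- The quotient of a comodule algebra by a costable ideal. -/
def ComodAlg.quotient (R : ComodAlg Q) {R' : C} [MonObj R'] [IsCommMonObj R'] (c : R.X ⟶ R')
    [IsMonHom c] [Epi c] (r : R' ⟶ R' ⊗ Q) (hr : R.coact ≫ c ▷ Q = c ≫ r) : ComodAlg Q where
  X := R'
  coact := r
  coact_counit := by
    rw [← cancel_epi c, ← reassoc_of% hr, ← whisker_exchange, reassoc_of% R.coact_counit,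
      rightUnitor_inv_naturality]
  coact_comul := by
    have h : c ≫ r ≫ r ▷ Q = R.coact ≫ R.coact ▷ Q ≫ c ▷ Q ▷ Q := by
      rw [← reassoc_of% hr, ← comp_whiskerRight, ← hr, comp_whiskerRight]
    rw [← cancel_epi c, ← reassoc_of% hr, ← whisker_exchange, reassoc_of% R.coact_comul,
      reassoc_of% h]
    simp
  isMonHom_coact := isMonHom_of_epi_comp c r (by rw [← hr]; infer_instance)

/-- Ideal and costability conditions are factorizations through `j`, which need not be monic, so
that `j` can be an iterated product morphism whose image is a power of an ideal. -/
lemma ComodAlg.exists_quotient [Abelian C] [MonoidalPreadditive C] {R S : ComodAlg Q}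
    (π : R.X ⟶ S.X) (hπ : IsComodAlgHom R S π) {J : C} (j : J ⟶ R.X) (hj : j ≫ π = 0)
    (hideal : ∀ {Y : C} (y : Y ⟶ R.X), ∃ l, j ⋆ y = l ≫ j)
    (hcostable : ∃ s, j ≫ R.coact = s ≫ j ▷ Q) :
    ∃ (R' : ComodAlg Q) (c : R.X ⟶ R'.X) (π' : R'.X ⟶ S.X), Epi c ∧ IsComodAlgHom R R' c ∧
      IsComodAlgHom R' S π' ∧ SplitExact j c ∧ c ≫ π' = π := by
  have := hπ.isMonHom
  let c := cokernel.π j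
  have hjc : j ≫ c = 0 := cokernel.condition j
  obtain ⟨_, _, hcm⟩ := exists_monObj_quotient c (fun x y hx => by
    obtain ⟨l, rfl⟩ := (splitExact_cokernel j).exists_lift x hx
    obtain ⟨l', hl'⟩ := hideal y
    rw [← whiskerRight_extMul, hl', Category.assoc, Category.assoc, hjc, comp_zero, comp_zero])
  have hjr : j ≫ R.coact ≫ c ▷ Q = 0 := by
    obtain ⟨s, hs⟩ := hcostable
    rw [reassoc_of% hs, ← comp_whiskerRight, hjc]
    simp
  have hr : R.coact ≫ c ▷ Q = c ≫ cokernel.desc j _ hjr := (cokernel.π_desc _ _ _).symm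
  have hcπ : c ≫ cokernel.desc j π hj = π := cokernel.π_desc _ _ _
  refine ⟨R.quotient c _ hr, c, cokernel.desc j π hj, inferInstanceAs (Epi (cokernel.π j)),
    ⟨hcm, hr⟩, ⟨isMonHom_of_epi_comp c _ (by rwa [hcπ]), ?_⟩, splitExact_cokernel j, hcπ⟩
  change cokernel.desc j _ hjr ≫ cokernel.desc j π hj ▷ Q = cokernel.desc j π hj ≫ S.coact
  rw [← cancel_epi c, ← reassoc_of% hr, ← comp_whiskerRight, hcπ, hπ.colinear, reassoc_of% hcπ]

end Quotient

section Nilpotent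

variable [Abelian C] [SplitEpiCategory C] [SymmetricCategory C] [MonoidalPreadditive C]
  {H : C} [HopfObj H] [IsCommMonObj H]

/-- With exponent `n + 1`, the base case has zero kernel. In the inductive step, with I the kernel
and J = Iⁿ⁺¹, first lift to R/J, then along R → R/J, whose kernel has square zero because J·I = 0.
-/
lemma exists_comodAlgHom_lift_of_mulPow [Mono (muHom H)] (n : ℕ) {R S : ComodAlg H}
    (π : R.X ⟶ S.X) [Epi π] (hπ : IsComodAlgHom R S π)
    (hn : mulPow (kernel.ι π) (n + 1) = 0) (f : H ⟶ S.X)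
    (hf : IsComodAlgHom (ComodAlg.regular H) S f) :
    ∃ g : H ⟶ R.X, IsComodAlgHom (ComodAlg.regular H) R g ∧ g ≫ π = f := by
  induction n generalizing R with
  | zero =>
    have hk : kernel.ι π = 0 := by
      rw [← cancel_epi (λ_ (kernel π)).hom, comp_zero]
      exact (mulPow_one _).symm.trans hn
    refine exists_comodAlgHom_lift_of_isSquareZero (fun X Y x y hx hy => ?_) hπ hf
    rw [← kernel.lift_ι π x hx, hk, comp_zero, zero_extMul]
  | succ n ih =>
    have := hπ.isMonHom
    let k := kernel.ι π
    have hk : k ≫ π = 0 := kernel.condition π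
    obtain ⟨R', c, π', _, hc, hπ', hex, hcπ⟩ := ComodAlg.exists_quotient π hπ (mulPow k n ⋆ k)
      (by rw [extMul_comp, hk, extMul_zero])
      (fun y => by
        have h : (k ⋆ y) ≫ π = 0 := by rw [extMul_comp, hk, zero_extMul]
        exact ⟨(α_ _ _ _).hom ≫ _ ◁ kernel.lift π _ h, by
          rw [extMul_assoc, Category.assoc, whiskerLeft_extMul, kernel.lift_ι]⟩)
      (by
        obtain ⟨r, hr⟩ := exists_kernel_coact (R := R.toRightComod) (S := S.toRightComod) π
          hπ.colinear
        obtain ⟨s, hs⟩ := exists_mulPow_whiskerRight k H (n + 1)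
        refine ⟨tensorPowMap r (n + 1) ≫ s, (mulPow_comp k R.coact (n + 1)).trans ?_⟩
        rw [← hr, ← tensorPowMap_mulPow, hs]
        exact (Category.assoc _ _ _).symm)
    have : IsMonHom c := hc.isMonHom
    have : Epi π' := epi_of_epi_fac hcπ
    obtain ⟨s, hs⟩ := exists_section c
    obtain ⟨g', hg', hg'π⟩ := ih π' hπ' (by
      have h : (kernel.ι π' ≫ s) ≫ π = 0 := by
        rw [← hcπ, Category.assoc, reassoc_of% hs, kernel.condition]
      have e : kernel.ι π' = kernel.lift π _ h ≫ k ≫ c := by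
        rw [kernel.lift_ι_assoc, Category.assoc, hs, Category.comp_id]
      have hz : mulPow k (n + 1) ≫ c = 0 := hex.zero
      rw [e, ← tensorPowMap_mulPow, ← mulPow_comp, hz, comp_zero])
    obtain ⟨g, hg, hgc⟩ := exists_comodAlgHom_lift_of_isSquareZero (π := c)
      (fun X Y x y hx hy => by
        obtain ⟨l, rfl⟩ := hex.exists_lift x hx
        have hy' : y ≫ π = 0 := by rw [← hcπ, reassoc_of% hy, zero_comp]
        have hz : (mulPow k n ⋆ k) ⋆ k = 0 := hn
        rw [← kernel.lift_ι π y hy', ← tensorHom_extMul, hz, comp_zero]) hc hg'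
    exact ⟨g, hg, by rw [← hcπ, reassoc_of% hgc, hg'π]⟩

theorem regular_isSmooth_of_mono_muHom [Mono (muHom H)] : (ComodAlg.regular H).IsSmooth :=
  fun _ _ π _ hπ ⟨n, hn⟩ f hf =>
    exists_comodAlgHom_lift_of_mulPow n π hπ (mulPow_succ_eq_zero _ hn) f hf

end Nilpotent

/-! ### Exchanging left and right comodules by the antipode. -/

section Antipode

open scoped HopfObj

variable [BraidedCategory C]

/-- In the commutative case 𝒮 is multiplicative, so 𝒮² and the identity are both convolution
inverses of 𝒮. -/
lemma antipode_antipode (H : C) [HopfObj H] [IsCommMonObj H] : 𝒮[H] ≫ 𝒮[H] = 𝟙 H := by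
  have h : (𝒮[H] ⊗ₘ 𝒮[H]) ≫ μ[H] = μ[H] ≫ 𝒮[H] := by
    rw [HopfObj.mul_antipode, IsCommMonObj.mul_comm]
  refine left_inv_eq_right_inv (M := Conv H H) (a := 𝒮[H]) ?_ ?_
  · change Δ[H] ≫ (𝒮[H] ≫ 𝒮[H]) ▷ H ≫ H ◁ 𝒮[H] ≫ μ[H] = ε[H] ≫ η[H]
    rw [comp_whiskerRight, Category.assoc,
      ← MonoidalCategory.tensorHom_def_assoc, h, HopfObj.antipode_left_assoc,
      HopfObj.one_antipode]
  · change Δ[H] ≫ 𝒮[H] ▷ H ≫ H ◁ 𝟙 H ≫ μ[H] = ε[H] ≫ η[H]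
    rw [MonoidalCategory.whiskerLeft_id, Category.id_comp,
      HopfObj.antipode_left]

instance (H : C) [HopfObj H] [IsCommMonObj H] : IsIso 𝒮[H] :=
  ⟨𝒮[H], antipode_antipode H, antipode_antipode H⟩

lemma associator_braiding_braiding_tensor (X Y Z : C) :
    (α_ X Y Z).hom ≫ X ◁ (β_ Y Z).hom ≫ (β_ X (Z ⊗ Y)).hom ≫ (α_ Z Y X).hom =
      (β_ X Y).hom ▷ Z ≫ (β_ (Y ⊗ X) Z).hom := by
  rw [BraidedCategory.braiding_naturality_right_assoc]
  simp [BraidedCategory.braiding_tensor_left_hom, BraidedCategory.braiding_tensor_right_hom]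

/-- The left comodule obtained from a right comodule by means of the antipode. -/
def RightComod.toLeft {Q : C} [HopfObj Q] (R : RightComod Q) : LeftComod Q where
  X := R.X
  coact := R.coact ≫ R.X ◁ 𝒮[Q] ≫ (β_ R.X Q).hom
  coact_counit := by
    rw [Category.assoc, Category.assoc, ← BraidedCategory.braiding_naturality_right,
      ← MonoidalCategory.whiskerLeft_comp_assoc, HopfObj.antipode_counit,
      reassoc_of% R.coact_counit]
    simp
  coact_comul := by
    have h := associator_braiding_braiding_tensor R.X Q Q
    simp only [Category.assoc]
    rw [← BraidedCategory.braiding_naturality_right_assoc,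
      ← MonoidalCategory.whiskerLeft_comp_assoc, HopfObj.antipode_comul,
      MonoidalCategory.whiskerLeft_comp_assoc, reassoc_of% R.coact_comul,
      ← BraidedCategory.braiding_naturality, MonoidalCategory.whiskerLeft_comp_assoc]
    have e : (β_ R.X Q).hom ≫ Q ◁ (R.coact ≫ R.X ◁ 𝒮[Q] ≫ (β_ R.X Q).hom) =
      (R.coact ▷ Q ≫ (R.X ◁ 𝒮[Q]) ▷ Q ≫ (β_ R.X Q).hom ▷ Q) ≫ (β_ (Q ⊗ R.X) Q).hom := by
      rw [← BraidedCategory.braiding_naturality_left]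
      simp only [comp_whiskerRight]
    rw [e]
    simp only [Category.assoc]
    rw [← h, whisker_exchange_assoc]
    simp [MonoidalCategory.tensorHom_def']

end Antipode

/-! ### Costable subalgebras and cofree comodule algebras. -/

section Subalgebra

variable [Abelian C] [SplitEpiCategory C]

lemma exists_lift_equalizer_whiskerRight [MonoidalPreadditive C] {X Y : C}
    (a b : X ⟶ Y) (U : C) {Z : C} (x : Z ⟶ X ⊗ U) (hx : x ≫ a ▷ U = x ≫ b ▷ U) :
    ∃ l, l ≫ equalizer.ι a b ▷ U = x := by
  refine ((splitExact_of_exists_lift (equalizer.ι a b) (a - b)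
    (by rw [Preadditive.comp_sub, equalizer.condition, sub_self]) fun y hy =>
      ⟨equalizer.lift y (by rwa [Preadditive.comp_sub, sub_eq_zero] at hy),
        equalizer.lift_ι _ _⟩).whiskerRight U).exists_lift x ?_
  have : (a - b) ▷ U = a ▷ U - b ▷ U := by
    rw [eq_sub_iff_add_eq, ← MonoidalPreadditive.add_whiskerRight, sub_add_cancel]
  rw [this, Preadditive.comp_sub, hx, sub_self]

/-- A costable subalgebra of a comodule algebra. -/
def ComodAlg.sub [BraidedCategory C] {Q : C} [BimonObj Q] (B : ComodAlg Q) {T : C} (e : T ⟶ B.X)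
    [Mono e] (o : 𝟙_ C ⟶ T) (ho : o ≫ e = η[B.X]) (m : T ⊗ T ⟶ T)
    (hm : m ≫ e = (e ⊗ₘ e) ≫ μ[B.X]) (r : T ⟶ T ⊗ Q) (hr : r ≫ e ▷ Q = e ≫ B.coact) :
    ComodAlg Q :=
  have hQ := mono_whiskerRight e Q
  let M : MonObj T :=
    { one := o
      mul := m
      one_mul := by
        rw [← cancel_mono e, Category.assoc, hm, ← tensorHom_id, tensorHom_comp_tensorHom_assoc,
          ho, Category.id_comp]
        exact one_extMul e
      mul_one := by
        rw [← cancel_mono e, Category.assoc, hm, ← id_tensorHom, tensorHom_comp_tensorHom_assoc,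
          ho, Category.id_comp]
        exact extMul_one e
      mul_assoc := by
        rw [← cancel_mono e]
        simp only [Category.assoc]
        rw [hm, ← tensorHom_id, ← id_tensorHom, tensorHom_comp_tensorHom_assoc,
          tensorHom_comp_tensorHom_assoc, hm, Category.id_comp]
        exact extMul_assoc e e e }
  have hμ : μ[T] = m := rfl
  have hη : η[T] = o := rfl
  { X := T
    coact := r
    coact_counit := by
      have := mono_whiskerRight e (𝟙_ C)
      rw [← cancel_mono (e ▷ 𝟙_ C), Category.assoc, whisker_exchange, reassoc_of% hr,
        B.coact_counit, rightUnitor_inv_naturality]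
    coact_comul := by
      have := mono_whiskerRight e (Q ⊗ Q)
      rw [← cancel_mono (e ▷ (Q ⊗ Q)), Category.assoc, whisker_exchange, reassoc_of% hr,
        B.coact_comul]
      simp only [Category.assoc]
      rw [← associator_naturality_left, ← comp_whiskerRight_assoc, hr, comp_whiskerRight_assoc,
        reassoc_of% hr]
    mon := M
    comm := ⟨by
      rw [← cancel_mono e, hμ, Category.assoc, hm, ← BraidedCategory.braiding_naturality_assoc,
        IsCommMonObj.mul_comm]⟩
    isMonHom_coact := by
      have he : IsMonHom e := ⟨ho, hm⟩
      refine ⟨?_, ?_⟩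
      · rw [← cancel_mono (e ▷ Q), Category.assoc, hr, IsMonHom.one_hom_assoc, IsMonHom.one_hom,
          IsMonHom.one_hom]
      · rw [← cancel_mono (e ▷ Q), Category.assoc, hr, IsMonHom.mul_hom_assoc, IsMonHom.mul_hom,
          Category.assoc, IsMonHom.mul_hom, tensorHom_comp_tensorHom_assoc,
          tensorHom_comp_tensorHom_assoc, hr] }

end Subalgebra

section Cofree

variable [SymmetricCategory C]

/-- The cofree comodule algebra `R ⊗ H`. -/
def ComodAlg.cofree (R H : C) [MonObj R] [IsCommMonObj R] [BimonObj H] [IsCommMonObj H] :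
    ComodAlg H where
  X := R ⊗ H
  coact := R ◁ Δ[H] ≫ (α_ R H H).inv
  coact_counit := by
    rw [Category.assoc, ← associator_inv_naturality_right,
      ← MonoidalCategory.whiskerLeft_comp_assoc, ComonObj.comul_counit]
    monoidal
  coact_comul := by
    have h := congrArg (R ◁ ·) (ComonObj.comul_assoc H)
    simp only [MonoidalCategory.whiskerLeft_comp] at h
    rw [Category.assoc, ← associator_inv_naturality_right, reassoc_of% h]
    simp
  isMonHom_coact := inferInstance

end Cofree

/-! ### Induction along H → Q and descent of smoothness. -/

section Induction

open scoped HopfObj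

variable {H Q : C}

section CoactRight

variable [ComonObj H] (q : H ⟶ Q)

/-- The morphism `r ⊗ h ↦ r ⊗ q(h₁) ⊗ h₂`. -/
def coactRight (R : C) : R ⊗ H ⟶ (R ⊗ Q) ⊗ H := R ◁ (Δ[H] ≫ q ▷ H) ≫ (α_ R Q H).inv

lemma coactRight_comul (R : C) :
    coactRight q R ≫ (R ⊗ Q) ◁ Δ[H] ≫ (α_ (R ⊗ Q) H H).inv =
      (R ◁ Δ[H] ≫ (α_ R H H).inv) ≫ coactRight q R ▷ H := by
  have e : (Δ[H] ≫ q ▷ H) ≫ Q ◁ Δ[H] = (Δ[H] ≫ (Δ[H] ≫ q ▷ H) ▷ H) ≫ (α_ Q H H).hom := by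
    rw [Category.assoc, ← whisker_exchange, ComonObj.comul_assoc_assoc]
    simp
  have e' := congrArg (R ◁ ·) e
  simp only [MonoidalCategory.whiskerLeft_comp] at e'
  simp only [coactRight, MonoidalCategory.whiskerLeft_comp, Category.assoc, comp_whiskerRight]
    at e' ⊢
  rw [← associator_inv_naturality_right_assoc, reassoc_of% e']
  simp

lemma coactRight_counit (R : C) :
    coactRight q R ≫ (R ⊗ Q) ◁ ε[H] ≫ (ρ_ _).hom = R ◁ q := by
  have e : (Δ[H] ≫ q ▷ H) ≫ Q ◁ ε[H] = (ρ_ H).inv ≫ q ▷ 𝟙_ C := by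
    rw [Category.assoc, ← whisker_exchange, ComonObj.comul_counit_assoc]
  rw [coactRight, Category.assoc, ← associator_inv_naturality_right_assoc,
    ← MonoidalCategory.whiskerLeft_comp_assoc, e]
  simp

lemma coactRight_naturality {R S : C} (π : R ⟶ S) :
    coactRight q R ≫ π ▷ Q ▷ H = π ▷ H ≫ coactRight q S := by
  rw [coactRight, coactRight, Category.assoc, ← associator_inv_naturality_left,
    whisker_exchange_assoc]

end CoactRight

variable [SymmetricCategory C]

instance isMonHom_counit (H : C) [BimonObj H] : IsMonHom ε[H] where
  one_hom := by simp
  mul_hom := by rw [Bimon.mul_counit]; rfl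

instance [BimonObj H] [MonObj Q] (q : H ⟶ Q) (R : C) [MonObj R] [IsMonHom q] :
    IsMonHom (coactRight q R) := by
  unfold coactRight
  infer_instance

/-- `e : T ⟶ R ⊗ H` exhibits `T` as the `H`-comodule algebra `R □_Q H`. -/
structure IsInduced [BimonObj H] [IsCommMonObj H] [BimonObj Q] (q : H ⟶ Q)
    (R : ComodAlg Q) (T : ComodAlg H) (e : T.X ⟶ R.X ⊗ H) : Prop where
  mono : Mono e
  hom : IsComodAlgHom T (ComodAlg.cofree R.X H) e
  condition : e ≫ R.coact ▷ H = e ≫ coactRight q R.X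
  exists_lift : ∀ {X : C} (x : X ⟶ R.X ⊗ H), x ≫ R.coact ▷ H = x ≫ coactRight q R.X →
    ∃ l, l ≫ e = x

section Antipode

/-- The morphism `r ⊗ h ↦ 𝒮(h) ⊗ r`. -/
def antipodeSwap (H R : C) [HopfObj H] : R ⊗ H ⟶ H ⊗ R := R ◁ 𝒮[H] ≫ (β_ R H).hom

instance (H R : C) [HopfObj H] [IsCommMonObj H] : IsIso (antipodeSwap H R) := by
  unfold antipodeSwap
  infer_instance

/-- The morphism `r ⊗ x ⊗ h ↦ 𝒮(h) ⊗ 𝒮(x) ⊗ r`. -/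
def antipodeSwap₂ (H Q R : C) [HopfObj H] [HopfObj Q] : (R ⊗ Q) ⊗ H ⟶ (H ⊗ Q) ⊗ R :=
  (α_ R Q H).hom ≫ R ◁ ((β_ Q H).hom ≫ (𝒮[H] ⊗ₘ 𝒮[Q])) ≫ (β_ R (H ⊗ Q)).hom

instance (H Q R : C) [HopfObj H] [HopfObj Q] [IsCommMonObj H] [IsCommMonObj Q] :
    IsIso (antipodeSwap₂ H Q R) := by
  unfold antipodeSwap₂
  infer_instance

/-- Together with `coact_antipodeSwap₂`, this matches the two morphisms defining R □_Q H with those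
defining H □_Q R, where `R` is made a left comodule by the antipode. Coflatness speaks of the second
form. -/
lemma coactRight_antipodeSwap₂ [HopfObj H] [HopfObj Q] (q : H ⟶ Q) [IsBimonHom q] (R : C) :
    coactRight q R ≫ antipodeSwap₂ H Q R = antipodeSwap H R ≫ (Δ[H] ≫ H ◁ q) ▷ R := by
  have h : (Δ[H] ≫ q ▷ H) ≫ (β_ Q H).hom ≫ (𝒮[H] ⊗ₘ 𝒮[Q]) = 𝒮[H] ≫ Δ[H] ≫ H ◁ q := by
    have := HopfObj.antipode_comul H
    rw [reassoc_of% this, Category.assoc, BraidedCategory.braiding_naturality_left_assoc,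
      ← id_tensorHom, tensorHom_comp_tensorHom, tensorHom_comp_tensorHom,
      HopfObj.hom_antipode q, Category.id_comp, Category.comp_id]
  rw [antipodeSwap, Category.assoc, ← BraidedCategory.braiding_naturality_right,
    ← MonoidalCategory.whiskerLeft_comp_assoc, ← h, coactRight, antipodeSwap₂,
    Category.assoc, Iso.inv_hom_id_assoc, ← MonoidalCategory.whiskerLeft_comp_assoc]

lemma coact_antipodeSwap₂ [HopfObj H] [HopfObj Q] (R : RightComod Q) :
    R.coact ▷ H ≫ antipodeSwap₂ H Q R.X =
      antipodeSwap H R.X ≫ H ◁ (R.coact ≫ R.X ◁ 𝒮[Q] ≫ (β_ R.X Q).hom) ≫ (α_ H Q R.X).inv := by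
  have h := associator_braiding_braiding_tensor R.X Q H
  have e : antipodeSwap H R.X ≫ H ◁ (R.coact ≫ R.X ◁ 𝒮[Q] ≫ (β_ R.X Q).hom) = R.X ◁ 𝒮[H] ≫
      (R.coact ▷ H ≫ (R.X ◁ 𝒮[Q]) ▷ H ≫ (β_ R.X Q).hom ▷ H) ≫ (β_ (Q ⊗ R.X) H).hom := by
    rw [antipodeSwap, Category.assoc, ← BraidedCategory.braiding_naturality_left]
    simp only [comp_whiskerRight]
  rw [reassoc_of% e]
  rw [← reassoc_of% h, antipodeSwap₂, ← BraidedCategory.braiding_naturality,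
    whisker_exchange_assoc, MonoidalCategory.tensorHom_def']
  simp only [MonoidalCategory.whiskerLeft_comp, Category.assoc]
  simp

end Antipode

variable [Abelian C] [SplitEpiCategory C] [MonoidalPreadditive C]

/-- The equalizer of two algebra morphisms is a subalgebra of R ⊗ H; it is costable because
tensoring with `H` preserves it. -/
lemma exists_isInduced [BimonObj H] [IsCommMonObj H] [BimonObj Q] (q : H ⟶ Q) [IsMonHom q]
    (R : ComodAlg Q) : ∃ (T : ComodAlg H) (e : T.X ⟶ R.X ⊗ H), IsInduced q R T e := by
  let e : equalizer (R.coact ▷ H) (coactRight q R.X) ⟶ R.X ⊗ H := equalizer.ι _ _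
  have he : e ≫ R.coact ▷ H = e ≫ coactRight q R.X := equalizer.condition _ _
  have hem : Mono e := inferInstanceAs (Mono (equalizer.ι _ _))
  have lift {X : C} (x : X ⟶ R.X ⊗ H) (hx : x ≫ R.coact ▷ H = x ≫ coactRight q R.X) :
      ∃ l, l ≫ e = x := ⟨equalizer.lift x hx, equalizer.lift_ι _ _⟩
  obtain ⟨o, ho⟩ := lift η[R.X ⊗ H] (by rw [IsMonHom.one_hom, IsMonHom.one_hom])
  obtain ⟨m, hm⟩ := lift (extMul e e) (by rw [extMul_comp, extMul_comp, he])
  obtain ⟨r, hr⟩ := exists_lift_equalizer_whiskerRight (R.coact ▷ H) (coactRight q R.X) H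
    (e ≫ R.X ◁ Δ[H] ≫ (α_ R.X H H).inv) (by
      have h := coactRight_comul q R.X
      simp only [Category.assoc] at h ⊢
      rw [← h, ← reassoc_of% he, ← associator_inv_naturality_left, whisker_exchange_assoc])
  exact ⟨@ComodAlg.sub _ _ _ _ _ _ _ _ (ComodAlg.cofree R.X H) _ e hem o ho m hm r hr, e, hem,
    ⟨⟨ho, hm⟩, hr⟩, he, lift⟩

section Coflat

variable [HopfObj H] [IsCommMonObj H] [HopfObj Q] (q : H ⟶ Q) [IsBimonHom q]
  [IsCommMonObj Q]

lemma IsInduced.epi {R S : ComodAlg Q} {T U : ComodAlg H} {e : T.X ⟶ R.X ⊗ H}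
    {e' : U.X ⟶ S.X ⊗ H} (hT : IsInduced q R T e) (hU : IsInduced q S U e')
    (hq : IsCoflat (ComodAlg.ofHom q).toRightComod) (π : R.X ⟶ S.X) [Epi π]
    (hπ : R.coact ≫ π ▷ Q = π ≫ S.coact) (φ : T.X ⟶ U.X) (hφ : φ ≫ e' = e ≫ π ▷ H) : Epi φ := by
  let V := (ComodAlg.ofHom q).toRightComod
  let K := kernelComod (R := R.toRightComod) (S := S.toRightComod) π hπ
  have hk : K.coact ≫ kernel.ι π ▷ Q = kernel.ι π ≫ R.coact := kernelComod_coact _ _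
  let toLeftHom {A B : RightComod Q} (g : A.X ⟶ B.X) (hg : A.coact ≫ g ▷ Q = g ≫ B.coact) :
      A.toLeft ⟶ B.toLeft := ⟨g, by
    change (A.coact ≫ A.X ◁ 𝒮[Q] ≫ (β_ A.X Q).hom) ≫ Q ◁ g =
      g ≫ B.coact ≫ B.X ◁ 𝒮[Q] ≫ (β_ B.X Q).hom
    rw [← reassoc_of% hg, Category.assoc, Category.assoc,
      ← BraidedCategory.braiding_naturality_left, whisker_exchange_assoc]⟩
  let f₁ : K.toLeft ⟶ R.toRightComod.toLeft := toLeftHom (kernel.ι π) hk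
  let f₂ : R.toRightComod.toLeft ⟶ S.toRightComod.toLeft := toLeftHom π hπ
  obtain ⟨w', hw'⟩ := hq _ _ _ f₁ f₂ (kernel.condition π)
    { exact := ShortComplex.exact_kernel π
      mono_f := inferInstanceAs (Mono (kernel.ι π))
      epi_g := inferInstanceAs (Epi π) }
  have hepi : Epi (cotensorMap V f₂) := hw'.epi_g
  obtain ⟨s, hs⟩ := exists_section (cotensorMap V f₂)
  let iR : cotensorObj V R.toRightComod.toLeft ⟶ H ⊗ R.X := cotensorι V _
  let iS : cotensorObj V S.toRightComod.toLeft ⟶ H ⊗ S.X := cotensorι V _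
  have hi : cotensorMap V f₂ ≫ iS = iR ≫ H ◁ π := cotensorMap_ι V f₂
  have hR : iR ≫ (Δ[H] ≫ H ◁ q) ▷ R.X =
      iR ≫ H ◁ (R.coact ≫ R.X ◁ 𝒮[Q] ≫ (β_ R.X Q).hom) ≫ (α_ H Q R.X).inv := cotensorι_condition V _
  obtain ⟨m, hm⟩ : ∃ m : U.X ⟶ cotensorObj V S.toRightComod.toLeft,
      m ≫ iS = e' ≫ antipodeSwap H S.X := by
    refine ⟨equalizer.lift (e' ≫ antipodeSwap H S.X) ?_, equalizer.lift_ι _ _⟩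
    change (e' ≫ antipodeSwap H S.X) ≫ (Δ[H] ≫ H ◁ q) ▷ S.X =
      (e' ≫ antipodeSwap H S.X) ≫ H ◁ (S.coact ≫ S.X ◁ 𝒮[Q] ≫ (β_ S.X Q).hom) ≫
        (α_ H Q S.X).inv
    rw [Category.assoc, Category.assoc, ← coact_antipodeSwap₂, ← coactRight_antipodeSwap₂,
      reassoc_of% hU.condition]
  -- By coflatness H □_Q R → H □_Q S is epic; a section of it, conjugated by the antipode swap, is a
  -- section of `φ`.
  obtain ⟨v, hv⟩ := hT.exists_lift (m ≫ s ≫ iR ≫ inv (antipodeSwap H R.X)) (by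
    rw [← cancel_mono (antipodeSwap₂ H Q R.X)]
    simp only [Category.assoc]
    rw [coact_antipodeSwap₂ R.toRightComod, coactRight_antipodeSwap₂, IsIso.inv_hom_id_assoc,
      IsIso.inv_hom_id_assoc, hR])
  have := hU.mono
  have hnat : antipodeSwap H R.X ≫ H ◁ π = π ▷ H ≫ antipodeSwap H S.X := by
    rw [antipodeSwap, antipodeSwap, Category.assoc, ← BraidedCategory.braiding_naturality_left,
      whisker_exchange_assoc]
  have hvφ : v ≫ φ = 𝟙 _ := by
    rw [← cancel_mono e', ← cancel_mono (antipodeSwap H S.X), Category.assoc, Category.assoc,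
      reassoc_of% hφ, ← hnat, reassoc_of% hv, IsIso.inv_hom_id_assoc, ← hi, reassoc_of% hs,
      hm, Category.id_comp]
  exact epi_of_epi_fac hvφ

/-- Smoothness over `H` descends to smoothness over `Q` along a coflat `q : H ⟶ Q`: colinear lifting
problems over `Q` are transported along the functor `- □_Q H`. -/
theorem ofHom_isSmooth (h : (ComodAlg.regular H).IsSmooth)
    (hq : IsCoflat (ComodAlg.ofHom q).toRightComod) : (ComodAlg.ofHom q).IsSmooth := by
  intro R S π _ hπ ⟨n, hn⟩ f hf
  change H ⟶ S.X at f
  obtain ⟨T, e, hT⟩ := exists_isInduced q R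
  obtain ⟨U, e', hU⟩ := exists_isInduced q S
  have := hπ.isMonHom
  have : IsMonHom f := hf.isMonHom
  have := hT.mono
  have := hU.mono
  have he := hT.hom.isMonHom
  have he' := hU.hom.isMonHom
  change IsMonHom (M := T.X) (N := R.X ⊗ H) e at he
  change IsMonHom (M := U.X) (N := S.X ⊗ H) e' at he'
  have hec : T.coact ≫ e ▷ H = e ≫ R.X ◁ Δ[H] ≫ (α_ R.X H H).inv := hT.hom.colinear
  have hec' : U.coact ≫ e' ▷ H = e' ≫ S.X ◁ Δ[H] ≫ (α_ S.X H H).inv := hU.hom.colinear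
  have := mono_whiskerRight e' H
  have hom_of_comp {X : C} [MonObj X] (x : X ⟶ U.X) (hx : IsMonHom (x ≫ e')) : IsMonHom x :=
    ⟨by rw [← cancel_mono e', Category.assoc, IsMonHom.one_hom, IsMonHom.one_hom],
      by rw [← cancel_mono e', Category.assoc, IsMonHom.mul_hom, Category.assoc, IsMonHom.mul_hom,
        tensorHom_comp_tensorHom_assoc]⟩
  obtain ⟨φ, hφ⟩ := hU.exists_lift (e ≫ π ▷ H) (by
    rw [Category.assoc, Category.assoc, ← coactRight_naturality, ← comp_whiskerRight,
      ← hπ.colinear, comp_whiskerRight, reassoc_of% hT.condition])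
  have hφe := hT.epi q hU hq π hπ.colinear φ hφ
  have hφm : IsComodAlgHom T U φ := by
    refine ⟨hom_of_comp φ (by rw [hφ]; infer_instance), ?_⟩
    rw [← cancel_mono (e' ▷ H), Category.assoc, Category.assoc, hec', ← comp_whiskerRight, hφ,
      comp_whiskerRight, reassoc_of% hec, reassoc_of% hφ, ← associator_inv_naturality_left,
      whisker_exchange_assoc]
  have hφn : IsNilpotentIdeal (kernel.ι φ) := by
    obtain ⟨l, hl⟩ := ((splitExact_kernel π).whiskerRight H).exists_lift (kernel.ι φ ≫ e) (by
      rw [Category.assoc, ← hφ, kernel.condition_assoc, zero_comp])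
    obtain ⟨s, hs⟩ := exists_mulPow_whiskerRight (kernel.ι π) H n
    refine ⟨n, ?_⟩
    rw [← cancel_mono e, mulPow_comp, ← hl, ← tensorPowMap_mulPow, hs, hn]
    simp
  -- The colinear morphism adjoint to `f`: by Q-colinearity, h ↦ f(h₁) ⊗ h₂ lands in S □_Q H.
  obtain ⟨F, hF⟩ := hU.exists_lift (Δ[H] ≫ f ▷ H) (by
    have hfc : (Δ[H] ≫ H ◁ q) ≫ f ▷ Q = f ≫ S.coact := hf.colinear
    rw [Category.assoc, Category.assoc, ← coactRight_naturality, ← comp_whiskerRight, ← hfc,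
      coactRight]
    simp)
  have hFm : IsComodAlgHom (ComodAlg.regular H) U F := by
    refine ⟨hom_of_comp (X := H) F (by rw [hF]; infer_instance), ?_⟩
    change Δ[H] ≫ F ▷ H = F ≫ U.coact
    rw [← cancel_mono (e' ▷ H), Category.assoc, Category.assoc, hec', ← comp_whiskerRight, hF,
      reassoc_of% hF, ← whisker_exchange_assoc, ComonObj.comul_assoc_assoc]
    simp
  obtain ⟨g, hg, hgφ⟩ := h T U φ hφm hφn F hFm
  change H ⟶ T.X at g
  have : IsMonHom g := hg.isMonHom
  have hgc : Δ[H] ≫ g ▷ H = g ≫ T.coact := hg.colinear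
  have hgm : IsMonHom (g ≫ e ≫ R.X ◁ ε[H] ≫ (ρ_ R.X).hom) :=
    have : IsMonHom (e ≫ R.X ◁ ε[H] ≫ (ρ_ R.X).hom) := inferInstance
    inferInstance
  -- Applying the counit of `H` undoes the adjunction; Q-colinearity comes from the equation
  -- defining R □_Q H.
  refine ⟨g ≫ e ≫ R.X ◁ ε[H] ≫ (ρ_ _).hom, ⟨hgm, ?_⟩, ?_⟩
  · change (Δ[H] ≫ H ◁ q) ≫ (g ≫ e ≫ R.X ◁ ε[H] ≫ (ρ_ _).hom) ▷ Q =
      (g ≫ e ≫ R.X ◁ ε[H] ≫ (ρ_ _).hom) ≫ R.coact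
    have hx : Δ[H] ≫ (g ≫ e) ▷ H = (g ≫ e) ≫ R.X ◁ Δ[H] ≫ (α_ R.X H H).inv := by
      rw [comp_whiskerRight, reassoc_of% hgc, hec, Category.assoc]
    have hxq : (g ≫ e) ≫ R.coact ▷ H = (g ≫ e) ≫ coactRight q R.X := by
      rw [Category.assoc, hT.condition, Category.assoc]
    rw [← Category.assoc g]
    generalize g ≫ e = x at hx hxq
    trans x ≫ R.X ◁ q
    · rw [Category.assoc, whisker_exchange, comp_whiskerRight_assoc, reassoc_of% hx,
        comp_whiskerRight_assoc, ← associator_inv_naturality_middle_assoc,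
        ← MonoidalCategory.whiskerLeft_comp_assoc, ComonObj.counit_comul]
      simp
    · rw [← coactRight_counit, ← reassoc_of% hxq, ← whisker_exchange_assoc]
      simp
  · have hgF : g ≫ φ = F := hgφ
    change (g ≫ e ≫ R.X ◁ ε[H] ≫ (ρ_ _).hom) ≫ π = f
    simp only [Category.assoc]
    rw [← rightUnitor_naturality, whisker_exchange_assoc, ← reassoc_of% hφ, reassoc_of% hgF,
      reassoc_of% hF, ← whisker_exchange_assoc, ComonObj.comul_counit_assoc]
    simp

end Coflat

end Induction

/-! ### The trivial quotient Hopf algebra. -/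

section Unit

variable [SymmetricCategory C]

/-- The unit object as a Hopf algebra. -/
abbrev unitHopfObj (C : Type u) [Category.{v} C] [MonoidalCategory C] [SymmetricCategory C] :
    HopfObj (𝟙_ C) where
  __ := ComonObj.instTensorUnit C
  mul_comul := by
    change (λ_ (𝟙_ C)).hom ≫ (λ_ (𝟙_ C)).inv = ((λ_ (𝟙_ C)).inv ⊗ₘ (λ_ (𝟙_ C)).inv) ≫
      tensorμ (𝟙_ C) (𝟙_ C) (𝟙_ C) (𝟙_ C) ≫ ((λ_ (𝟙_ C)).hom ⊗ₘ (λ_ (𝟙_ C)).hom)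
    rw [tensorμ, braiding_tensorUnit_left]
    monoidal
  one_comul := by
    change 𝟙 _ ≫ (λ_ (𝟙_ C)).inv = (λ_ (𝟙_ C)).inv ≫ (𝟙 (𝟙_ C) ⊗ₘ 𝟙 (𝟙_ C))
    simp
  mul_counit := by
    rw [Comon.tensorObj_counit]
    change (λ_ (𝟙_ C)).hom ≫ 𝟙 (𝟙_ C) = (𝟙 (𝟙_ C) ⊗ₘ 𝟙 (𝟙_ C)) ≫ _
    simp
  one_counit := by
    change 𝟙 _ ≫ 𝟙 (𝟙_ C) = 𝟙 _
    simp
  antipode := 𝟙 _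
  antipode_left := by
    change (λ_ (𝟙_ C)).inv ≫ 𝟙 (𝟙_ C) ▷ 𝟙_ C ≫ (λ_ (𝟙_ C)).hom = 𝟙 _ ≫ 𝟙 (𝟙_ C)
    simp
  antipode_right := by
    change (λ_ (𝟙_ C)).inv ≫ 𝟙_ C ◁ 𝟙 (𝟙_ C) ≫ (λ_ (𝟙_ C)).hom = 𝟙 _ ≫ 𝟙 (𝟙_ C)
    simp

attribute [local instance] unitHopfObj

lemma counit_unit : ε[𝟙_ C] = 𝟙 (𝟙_ C) := rfl

lemma comul_unit : Δ[𝟙_ C] = (λ_ (𝟙_ C)).inv := rfl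

instance : IsCommMonObj (𝟙_ C) where
  mul_comm := by
    change (β_ (𝟙_ C) (𝟙_ C)).hom ≫ (λ_ (𝟙_ C)).hom = (λ_ (𝟙_ C)).hom
    rw [braiding_tensorUnit_left]
    monoidal

instance (H : C) [BimonObj H] : IsBimonHom ε[H] where
  hom_counit := Category.comp_id _
  hom_comul := by
    change ε[H] ≫ (λ_ (𝟙_ C)).inv = Δ[H] ≫ (ε[H] ⊗ₘ ε[H])
    rw [MonoidalCategory.tensorHom_def, ComonObj.counit_comul_assoc]
    simp

lemma LeftComod.coact_unit (W : LeftComod (𝟙_ C)) : W.coact = (λ_ W.X).inv := by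
  simpa [counit_unit] using W.coact_counit

lemma RightComod.coact_unit (V : RightComod (𝟙_ C)) : V.coact = (ρ_ V.X).inv := by
  simpa [counit_unit] using V.coact_counit

/-- An algebra with the trivial coaction. -/
def ComodAlg.trivial (R : C) [MonObj R] [IsCommMonObj R] : ComodAlg (𝟙_ C) where
  X := R
  coact := (ρ_ R).inv
  coact_counit := by rw [counit_unit]; simp
  coact_comul := by rw [comul_unit]; monoidal
  isMonHom_coact := inferInstance

/-- Over the unit object, the cotensor product is the tensor product. -/
def cotensorIsoUnit [HasEqualizers C] (V : RightComod (𝟙_ C)) (W : LeftComod (𝟙_ C)) :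
    cotensorObj V W ≅ V.X ⊗ W.X :=
  have : IsIso (cotensorι V W) :=
    equalizer.ι_of_eq (by rw [V.coact_unit, W.coact_unit]; monoidal)
  asIso (cotensorι V W)

variable [Abelian C] [SplitEpiCategory C] [MonoidalPreadditive C]

lemma isCoflat_unit (V : RightComod (𝟙_ C)) : IsCoflat V := by
  intro W₁ W₂ W₃ f g w hS
  have w' : (cotensor V).map f ≫ (cotensor V).map g = 0 := by
    refine ((cotensor V).map_comp f g).symm.trans (cotensor_hom_ext ?_)
    refine (cotensorMap_ι V (f ≫ g)).trans (Eq.trans ?_ zero_comp.symm)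
    change _ ≫ V.X ◁ (f.hom ≫ g.hom) = 0
    rw [w, MonoidalPreadditive.whiskerLeft_zero, comp_zero]
  refine ⟨w', ?_⟩
  have := hS.epi_g
  obtain ⟨s, hs⟩ := exists_section g.hom
  have h := ((ShortComplex.Splitting.ofExactOfSection _ hS.exact s hs hS.mono_f).map
    (tensorLeft V.X)).shortExact
  refine ShortComplex.shortExact_of_iso (ShortComplex.isoMk (cotensorIsoUnit V W₁)
    (cotensorIsoUnit V W₂) (cotensorIsoUnit V W₃) ?_ ?_).symm h
  · exact (cotensorMap_ι V f).symm
  · exact (cotensorMap_ι V g).symm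

/-- Over Q = 𝟙 coactions are unitors, so every algebra morphism is colinear; coflatness is exactness
of the tensor product, and ε is epic since the unit splits it. -/
theorem isSmooth_of_ofHom_isSmooth (H : C) [HopfObj H] [IsCommMonObj H]
    (h : ∀ (Q : C) [HopfObj Q] [IsCommMonObj Q] (q : H ⟶ Q) [IsBimonHom q] [Epi q],
      IsCoflat (ComodAlg.ofHom q).toRightComod → (ComodAlg.ofHom q).IsSmooth) : IsSmooth H := by
  intro R S _ _ _ _ π _ _ hn f _
  have : Epi ε[H] := epi_of_epi_fac (BimonObj.one_counit H)
  have trivial_hom (A B : ComodAlg (𝟙_ C)) (x : A.X ⟶ B.X) [IsMonHom x] : IsComodAlgHom A B x :=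
    ⟨inferInstance, by
      rw [A.toRightComod.coact_unit, B.toRightComod.coact_unit, rightUnitor_inv_naturality]⟩
  obtain ⟨g, hg, hgπ⟩ := @h (𝟙_ C) _ _ ε[H] _ _ (isCoflat_unit _) (ComodAlg.trivial R)
    (ComodAlg.trivial S) π ‹_› (@trivial_hom (ComodAlg.trivial R) (ComodAlg.trivial S) π ‹_›) hn f
    (@trivial_hom (ComodAlg.ofHom ε[H]) (ComodAlg.trivial S) f ‹_›)
  exact ⟨g, hg.isMonHom, hgπ⟩

end Unit

end HopfSmooth

end

theorem theorem1p2 {C : Type u} [Category.{v} C] [Abelian C] [MonoidalCategory C]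
    [SymmetricCategory C] [MonoidalPreadditive C] (hC : IsSemisimpleCategory C)
    (H : C) [HopfObj H] [IsCommMonObj H] :
    List.TFAE [
      HopfSmooth.IsSmooth H,
      (HopfSmooth.ComodAlg.regular H).IsSmooth,
      ∀ (Q : C) [HopfObj Q] [IsCommMonObj Q] (q : H ⟶ Q) [IsBimonHom q] [Epi q],
        HopfSmooth.IsCoflat (HopfSmooth.ComodAlg.ofHom q).toRightComod →
          (HopfSmooth.ComodAlg.ofHom q).IsSmooth,
      Mono (HopfSmooth.muHom H)] := by
  have := HopfSmooth.splitEpiCategory_of_isSemisimpleCategory hC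
  tfae_have 1 → 4 := HopfSmooth.mono_muHom_of_isSmooth H
  tfae_have 4 → 2 := fun _ => HopfSmooth.regular_isSmooth_of_mono_muHom
  tfae_have 2 → 3 := fun h Q _ _ q _ _ hq => HopfSmooth.ofHom_isSmooth q h hq
  tfae_have 3 → 1 := HopfSmooth.isSmooth_of_ofHom_isSmooth H
  tfae_finish
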